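/- Let $n\ge 1$, $0<p<1$ and $\sigma\in J_n^+=\{s\ge 0: s(s+n-2)\ge 0\}$. Let $\mathcal B\varphi=(1-\Delta)^{-1}\varphi=B*\varphi$ be the Bessel potential operator on $\mathbb R^n$, $B(x)=(2\pi)^{-n/2}|x|^{(2-n)/2}K_{(n-2)/2}(|x|)$. For $a\in\mathbb R$ let $BC_a$ be the space of continuous $\varphi:\mathbb R^n\to\mathbb R$ with $|\varphi(x)|\le \mathrm{const}\cdot|x|^a$ as $|x|\to\infty$, normed by $\sup_x (1+|x|^2)^{-a/2}|\varphi(x)|$. For $0<\tau_0\le\infty$ put $\mathcal Z_{\tau_0,a}=C([0,\tau_0);BC_a)$ and $Q_{\tau_0}=\mathbb R^n\times[0,\tau_0)$. For the problem $\partial_tu-\Delta\partial_tu=\Delta u+V(x,t)u^p$ with initial datum $u_0$, a function $0\le u\in\mathcal Z_{\tau_0,a}$ is an s-supersolution if $\mu=e^tu$ satisfies $$\mu(t)\ \ge\ u_0+\int_0^t\mathcal B\mu(\tau)\,d\tau+\int_0^te^{(1-p)\tau}\mathcal B\big(V\mu^p\big)(\tau)\,d\tau\quad\text{on }Q_{\tau_0},$$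 and an s-subsolution if it satisfies the reverse inequality. Let $\Lambda\in C(\mathbb R)$ be positive. We say that a measurable $V\ge0$ satisfies (C) on $(0,\tau_0)$ with constants $\underline\vartheta,\overline\vartheta>0$ if $$V(x,t)\ge\underline\vartheta\,\Lambda(t)|x|^\sigma\ \ (|x|\ge1,\ 0<t<\tau_0),\qquad V(x,t)\le\overline\vartheta\,\Lambda(t)|x|^\sigma\ \ (x\in\mathbb R^n,\ 0<t<\tau_0),$$ and that $\varepsilon_0>0$ is admissible for $V$ if $$\mathcal B\big(V(\cdot,t)|\cdot|^d\big)(x)\ \ge\ \varepsilon_0\,\underline\vartheta\,\Lambda(t)|x|^{\sigma+d}\qquad\Big(x\in\mathbb R^n,\ 0<t<\tau_0,\ 0\le d\le\tfrac{\sigma p}{1-p}\Big).$$ (0) There is a constant $\varepsilon_0>0$, depending only on $n,\sigma,p$, which is admissible for every $V$ satisfying (C), whatever $\tau_0,\Lambda,\underline\vartheta,\overline\vartheta$ are. (1) (Comparison theorem) Let $V$ satisfy (C), let $\varepsilon_0>0$ be admissible for $V$, and assume $a\ge\sigma_+/(1-p)$ and $0<p<\varepsilon_0\,\underline\vartheta/\overline\vartheta$.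 Let $u_0,v_0\in BC_a$ with $u_0\ge v_0\ge0$ and $u_0\not\equiv0$. If $0\le u\in\mathcal Z_{\tau_0,a}$ is an s-supersolution with datum $u_0$ and $0\le v\in\mathcal Z_{\tau_0,a}$ is an s-subsolution with datum $v_0$, then $u\ge v$ on $Q_{\tau_0}$. (2) If $V(x,t)=\Lambda(t)|x|^\sigma$ for all $x\in\mathbb R^n$, $0<t<\tau_0$, and $a\ge\sigma_+/(1-p)$, then the conclusion of (1) holds for every $0<p<1$. -/

import Mathlib

open Real Set Filter Topology MeasureTheory

noncomputable section

namespace Pseudoparabolic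

/-- Euclidean space of dimension `n`. -/
abbrev E (n : ℕ) : Type := EuclideanSpace ℝ (Fin n)

/-- The time interval `[0, T)`, where `T` may be `⊤`. -/
def timeIco (T : EReal) : Set ℝ := {t : ℝ | 0 ≤ t ∧ (t : EReal) < T}

/-- The time interval `(0, T)`, where `T` may be `⊤`. -/
def timeIoo (T : EReal) : Set ℝ := {t : ℝ | 0 < t ∧ (t : EReal) < T}

/-- The modified Bessel function of the second kind `K_ν(z)`, for `z > 0`. -/
def besselK (ν z : ℝ) : ℝ :=
  (1 / 2) * (z / 2) ^ ν * ∫ s in Ioi (0 : ℝ), exp (-s - z ^ 2 / (4 * s)) * s ^ (-ν - 1)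

/-- The kernel of the Bessel potential `(1 - Δ)⁻¹` on `ℝⁿ`,
`B(x) = (2π)^(-n/2) |x|^((2-n)/2) K_((n-2)/2)(|x|)`, which is normalized to have integral one. -/
def besselKernel (n : ℕ) (x : E n) : ℝ :=
  (2 * π) ^ (-((n : ℝ) / 2)) * ‖x‖ ^ ((2 - (n : ℝ)) / 2) * besselK (((n : ℝ) - 2) / 2) ‖x‖

/-- Away from the origin the kernel is the Laplace transform at `1` of the heat kernel. -/
theorem besselKernel_eq_heat (n : ℕ) (x : E n) (hx : x ≠ 0) :
    besselKernel n x =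
      ∫ s in Ioi (0 : ℝ), exp (-s) * ((4 * π * s) ^ (-((n : ℝ) / 2)) *
        exp (-(‖x‖ ^ 2 / (4 * s)))) := by
  have hr : 0 < ‖x‖ := norm_pos_iff.mpr hx
  have hpi : (0 : ℝ) < π := Real.pi_pos
  have hc : (2 * π) ^ (-((n : ℝ) / 2)) * ‖x‖ ^ ((2 - (n : ℝ)) / 2) *
      ((1 / 2) * (‖x‖ / 2) ^ (((n : ℝ) - 2) / 2)) = (4 * π) ^ (-((n : ℝ) / 2)) := by
    have e0 : (2 - (n : ℝ)) / 2 = -(((n : ℝ) - 2) / 2) := by ring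
    have e1 : (4 * π : ℝ) = 2 * (2 * π) := by ring
    rw [Real.div_rpow hr.le (by norm_num), e0, Real.rpow_neg hr.le, e1,
      Real.mul_rpow (x := 2) (y := 2 * π) (by norm_num) (by positivity)]
    have h2 : (2 : ℝ) ^ (-((n : ℝ) / 2)) = (1 / 2) * ((2 : ℝ) ^ (((n : ℝ) - 2) / 2))⁻¹ := by
      rw [← Real.rpow_neg (by norm_num)]
      have : (1 / 2 : ℝ) = (2 : ℝ) ^ (-1 : ℝ) := by
        rw [Real.rpow_neg_one]; norm_num
      rw [this, ← Real.rpow_add (by norm_num)]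
      congr 1; ring
    rw [h2]
    have hne : ‖x‖ ^ (((n : ℝ) - 2) / 2) ≠ 0 := (Real.rpow_pos_of_pos hr _).ne'
    field_simp
  unfold besselKernel besselK
  rw [← mul_assoc, hc, ← integral_const_mul]
  refine setIntegral_congr_fun measurableSet_Ioi fun s hs => ?_
  have hs : 0 < s := hs
  have e3 : -(((n : ℝ) - 2) / 2) - 1 = -((n : ℝ) / 2) := by ring
  rw [Real.mul_rpow (by positivity) hs.le, e3, sub_eq_add_neg, Real.exp_add]
  ring

/-- The Bessel potential operator `𝓑 φ = B ∗ φ`. -/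
def besselOp {n : ℕ} (φ : E n → ℝ) (x : E n) : ℝ :=
  ∫ y : E n, besselKernel n (x - y) * φ y

/-- `φ ∈ BC_a`: `φ` is continuous and `|φ(x)| ≤ const · |x|^a` as `|x| → ∞`. -/
def MemBC {n : ℕ} (a : ℝ) (φ : E n → ℝ) : Prop :=
  Continuous φ ∧ ∃ C R₀ : ℝ, ∀ x : E n, R₀ ≤ ‖x‖ → |φ x| ≤ C * ‖x‖ ^ a

/-- The norm `‖φ‖_{R,a} = sup_x (R² + |x|²)^(-a/2) |φ(x)|` of `BC_a`. -/
def weightedNorm {n : ℕ} (R a : ℝ) (φ : E n → ℝ) : ℝ :=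
  ⨆ x : E n, (R ^ 2 + ‖x‖ ^ 2) ^ (-a / 2) * |φ x|

/-- `u ∈ 𝓩_{T,a} = C([0,T); BC_a)`. The norms `‖·‖_{R,a}`, `R > 0`, are all equivalent;
the one with `R = 1` is used. -/
def MemZ {n : ℕ} (T : EReal) (a : ℝ) (u : ℝ → E n → ℝ) : Prop :=
  (∀ t ∈ timeIco T, MemBC a (u t)) ∧
    ∀ t₀ ∈ timeIco T,
      Tendsto (fun t => weightedNorm 1 a (fun x => u t x - u t₀ x)) (𝓝[timeIco T] t₀) (𝓝 0)

/-- The operator `𝓜ˢ` with initial datum `u₀` and potential `V`: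
`𝓜ˢ μ (t) = u₀ + ∫₀ᵗ 𝓑 μ(τ) dτ + ∫₀ᵗ e^((1-p)τ) 𝓑 [V(τ) μ(τ)^p] dτ`. -/
def sMildOp {n : ℕ} (p : ℝ) (V : ℝ → E n → ℝ) (u₀ : E n → ℝ) (μ : ℝ → E n → ℝ)
    (t : ℝ) (x : E n) : ℝ :=
  u₀ x + (∫ τ in (0 : ℝ)..t, besselOp (μ τ) x) +
    ∫ τ in (0 : ℝ)..t, exp ((1 - p) * τ) * besselOp (fun y => V τ y * μ τ y ^ p) x

/-- `0 ≤ u ∈ 𝓩_{T,a}` is an s-supersolution on `ℝⁿ × [0,T)`: `μ = e^t u` satisfies `μ ≥ 𝓜ˢ μ`. -/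
structure IsSSupersolution {n : ℕ} (p : ℝ) (V : ℝ → E n → ℝ) (T : EReal) (a : ℝ)
    (u₀ : E n → ℝ) (u : ℝ → E n → ℝ) : Prop where
  nonneg : ∀ t ∈ timeIco T, ∀ x, 0 ≤ u t x
  memZ : MemZ T a u
  ge : ∀ t ∈ timeIco T, ∀ x,
    sMildOp p V u₀ (fun τ y => exp τ * u τ y) t x ≤ exp t * u t x

/-- `0 ≤ v ∈ 𝓩_{T,a}` is an s-subsolution on `ℝⁿ × [0,T)`: `ω = e^t v` satisfies `ω ≤ 𝓜ˢ ω`. -/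
structure IsSSubsolution {n : ℕ} (p : ℝ) (V : ℝ → E n → ℝ) (T : EReal) (a : ℝ)
    (v₀ : E n → ℝ) (v : ℝ → E n → ℝ) : Prop where
  nonneg : ∀ t ∈ timeIco T, ∀ x, 0 ≤ v t x
  memZ : MemZ T a v
  le : ∀ t ∈ timeIco T, ∀ x,
    exp t * v t x ≤ sMildOp p V v₀ (fun τ y => exp τ * v τ y) t x

/-- `J_n⁺ = {s ≥ 0 : s (s + n - 2) ≥ 0}`. -/
def JPlus (n : ℕ) : Set ℝ := {s : ℝ | 0 ≤ s * (s + n - 2) ∧ 0 ≤ s}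

/-- `V ≥ 0` is comparable to `Λ(t) |x|^σ` on `ℝⁿ × (0,T)` with constants `lo`, `hi`; the lower
bound is required for `|x| ≥ 1` only. -/
structure IsComparable {n : ℕ} (T : EReal) (σ : ℝ) (Λ : ℝ → ℝ) (lo hi : ℝ)
    (V : ℝ → E n → ℝ) : Prop where
  continuous : Continuous Λ
  pos : ∀ t, 0 < Λ t
  lo_pos : 0 < lo
  hi_pos : 0 < hi
  measurable : Measurable (fun z : ℝ × E n => V z.1 z.2)
  nonneg : ∀ t ∈ timeIoo T, ∀ x, 0 ≤ V t x
  lower : ∀ t ∈ timeIoo T, ∀ x : E n, 1 ≤ ‖x‖ → lo * Λ t * ‖x‖ ^ σ ≤ V t x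
  upper : ∀ t ∈ timeIoo T, ∀ x : E n, V t x ≤ hi * Λ t * ‖x‖ ^ σ

/-- `ε₀` is a constant in the lower estimate `𝓑(V |x|^d) ≥ ε₀ · lo Λ(t) |x|^(σ+d)` on
`ℝⁿ × (0,T)`, uniformly for `0 ≤ d ≤ D`. -/
def BesselLowerBound {n : ℕ} (T : EReal) (σ : ℝ) (Λ : ℝ → ℝ) (lo : ℝ) (V : ℝ → E n → ℝ)
    (D ε₀ : ℝ) : Prop :=
  ∀ d : ℝ, 0 ≤ d → d ≤ D → ∀ t ∈ timeIoo T, ∀ x : E n,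
    ε₀ * (lo * Λ t) * ‖x‖ ^ (σ + d) ≤ besselOp (fun y => V t y * ‖y‖ ^ d) x

end Pseudoparabolic

end

noncomputable section

namespace Pseudoparabolic

variable {n : ℕ}

/-! ### The Bessel kernel -/

/-! Since `r ↦ r^p` is not Lipschitz at `0`, comparison cannot come from Gronwall's inequality
alone. It rests on a lower bound for supersolutions strong enough to control the derivative `p
μ^(p-1)`. Put `m = 1/(1-p)` and `G(t) = ∫₀ᵗ e^((1-p)s) Λ(s) ds`. As `m p = m - 1`, inserting `μ ≥ A
G^m g` into the integral inequality reproduces the factor `G^m`, with new coefficient `A^p ε/m`.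
Iterating from an exponentially small bound (`exists_initial_lower_bound`), the decay rate is
multiplied by `p` at each step and disappears in the limit (`exists_uniform_lower_bound`). Iterating
again from a constant, the spatial power increases to `σ m` and the coefficient tends to the fixed
point `(ε₀ lo/m)^m` (`lower_bound`).

With this bound, concavity gives `e^((1-p)t) V (ω^p - μ^p) ≤ κ m (G'/G) W` for any nonnegative upper
bound `W` of `ω - μ`, where `κ = p hi/(ε₀ lo) < 1`. The singular coefficient `κ m G'/G` is harmless
on functions of size `G^m`, because `∫ κ m G' G^(m-1) = κ G^m`. That `ω - μ` is at most of this size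
is shown separately in `exists_sub_le`, by subadditivity of `r^p`. In a spatial weight with large
radius `R` the operator `𝓑` has norm close to `1`, and a factor `e^(lt)` makes the linear term
small, so the bound on `ω - μ` contracts to zero (`comparison`).

An admissible `ε₀` comes from the mass of the kernel on a half shell, where `|x - z| ≥ max(|x|, 1)`.
For the pure power potential `ε₀ = 1` is admissible, since `|x|^s` is subharmonic for `s ∈ J_n⁺` and
hence lies below its Bessel potential; the condition on `p` then reduces to `p < 1`. -/

theorem integrable_exp_neg_norm_sq_div {b : ℝ} (hb : 0 < b) :
    Integrable (fun z : E n => exp (-(‖z‖ ^ 2 / b))) := by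
  have h := GaussianFourier.integrable_cexp_neg_mul_sq_norm_add (V := E n)
    (b := ((1 / b : ℝ) : ℂ)) (by simpa using hb) 0 0
  refine (h.norm).congr (Eventually.of_forall fun z => ?_)
  simp only [Complex.norm_exp]
  congr 1
  have : (-((1 / b : ℝ) : ℂ) * (‖z‖ : ℂ) ^ 2 + 0 * ((inner ℝ (0 : E n) z : ℝ) : ℂ)) =
      ((-(‖z‖ ^ 2 / b) : ℝ) : ℂ) := by
    push_cast; ring
  rw [this, Complex.ofReal_re]

theorem integral_exp_neg_norm_sq_div {b : ℝ} (hb : 0 < b) :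
    ∫ z : E n, exp (-(‖z‖ ^ 2 / b)) = (π * b) ^ ((n : ℝ) / 2) := by
  have h := GaussianFourier.integral_rexp_neg_mul_sq_norm (V := E n) (b := 1 / b) (by positivity)
  simp only [finrank_euclideanSpace, Fintype.card_fin] at h
  rw [show π * b = π / (1 / b) by field_simp, ← h]
  congr 1; ext z; congr 1; ring

/-- The heat kernel at time `s`, damped by `exp (-c s)` and with variance scaled by `b / 4`. -/
def dampedHeat (n : ℕ) (c b : ℝ) (q : E n × ℝ) : ℝ :=
  exp (-(c * q.2)) * ((4 * π * q.2) ^ (-((n : ℝ) / 2)) * exp (-(‖q.1‖ ^ 2 / (b * q.2))))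

theorem measurable_dampedHeat (c b : ℝ) : Measurable (dampedHeat n c b) := by
  unfold dampedHeat; fun_prop

theorem dampedHeat_nonneg (c b : ℝ) {z : E n} {s : ℝ} (hs : 0 < s) :
    0 ≤ dampedHeat n c b (z, s) := by
  unfold dampedHeat; positivity

theorem integral_dampedHeat {c b s : ℝ} (hb : 0 < b) (hs : 0 < s) :
    ∫ z : E n, dampedHeat n c b (z, s) = (b / 4) ^ ((n : ℝ) / 2) * exp (-(c * s)) := by
  simp only [dampedHeat]
  have hp : 0 < (4 * π * s) ^ ((n : ℝ) / 2) := Real.rpow_pos_of_pos (by positivity) _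
  rw [integral_const_mul, integral_const_mul, integral_exp_neg_norm_sq_div (by positivity),
    Real.rpow_neg (by positivity), show π * (b * s) = (b / 4) * (4 * π * s) by ring,
    Real.mul_rpow (x := b / 4) (by positivity) (by positivity)]
  generalize (4 * π * s) ^ ((n : ℝ) / 2) = q at hp
  field_simp

theorem integrable_dampedHeat {c b : ℝ} (hc : 0 < c) (hb : 0 < b) :
    Integrable (dampedHeat n c b) (volume.prod (volume.restrict (Ioi (0 : ℝ)))) := by
  rw [integrable_prod_iff' (measurable_dampedHeat c b).aestronglyMeasurable]
  constructor
  · refine (ae_restrict_iff' measurableSet_Ioi).2 (Eventually.of_forall fun s hs => ?_)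
    have hs : 0 < s := hs
    unfold dampedHeat
    exact ((integrable_exp_neg_norm_sq_div (b := b * s) (by positivity)).const_mul
      ((4 * π * s) ^ (-((n : ℝ) / 2)))).const_mul (exp (-(c * s)))
  · have h : IntegrableOn (fun s : ℝ => (b / 4) ^ ((n : ℝ) / 2) * exp (-(c * s))) (Ioi 0) := by
      have := (integrableOn_exp_mul_Ioi (a := -c) (by linarith) 0).const_mul
        ((b / 4) ^ ((n : ℝ) / 2))
      simpa [neg_mul, IntegrableOn] using this
    refine h.congr_fun (fun s hs => ?_) measurableSet_Ioi
    have hs : 0 < s := hs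
    simp only [Real.norm_of_nonneg (dampedHeat_nonneg c b hs)]
    exact (integral_dampedHeat hb hs).symm

theorem besselKernel_congr {x y : E n} (h : ‖x‖ = ‖y‖) : besselKernel n x = besselKernel n y := by
  unfold besselKernel; rw [h]

theorem besselKernel_nonneg (x : E n) : 0 ≤ besselKernel n x := by
  unfold besselKernel besselK
  have : 0 ≤ ∫ s in Ioi (0 : ℝ), exp (-s - ‖x‖ ^ 2 / (4 * s)) *
      s ^ (-(((n : ℝ) - 2) / 2) - 1) :=
    setIntegral_nonneg measurableSet_Ioi fun s hs =>
      mul_nonneg (exp_pos _).le (Real.rpow_nonneg (le_of_lt hs) _)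
  positivity

theorem measurable_besselKernel : Measurable (besselKernel n) := by
  have h : Measurable (fun x : E n => ∫ s in Ioi (0 : ℝ), exp (-s - ‖x‖ ^ 2 / (4 * s)) *
      s ^ (-(((n : ℝ) - 2) / 2) - 1)) := by
    refine (StronglyMeasurable.integral_prod_right (f := fun (x : E n) (s : ℝ) =>
      exp (-s - ‖x‖ ^ 2 / (4 * s)) * s ^ (-(((n : ℝ) - 2) / 2) - 1)) ?_).measurable
    apply Measurable.stronglyMeasurable
    unfold Function.uncurry
    fun_prop
  unfold besselKernel besselK
  fun_prop

theorem besselKernel_eq_integral_dampedHeat {x : E n} (hx : x ≠ 0) :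
    besselKernel n x = ∫ s in Ioi (0 : ℝ), dampedHeat n 1 4 (x, s) := by
  rw [besselKernel_eq_heat n x hx]; simp [dampedHeat]

theorem nontrivial_E (hn : 1 ≤ n) : Nontrivial (E n) := by
  have : Nonempty (Fin n) := ⟨⟨0, hn⟩⟩
  infer_instance

theorem ae_ne_zero (hn : 1 ≤ n) : ∀ᵐ x : E n, x ≠ 0 := by
  have := nontrivial_E hn
  exact Measure.ae_ne volume 0

/-- The heat representation is available only off the origin, a null set because `n ≥ 1`. -/
theorem ae_besselKernel_eq (hn : 1 ≤ n) : ∀ᵐ x : E n,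
    besselKernel n x = ∫ s in Ioi (0 : ℝ), dampedHeat n 1 4 (x, s) := by
  filter_upwards [ae_ne_zero hn] with x hx using besselKernel_eq_integral_dampedHeat hx

theorem integral_besselKernel (hn : 1 ≤ n) : ∫ x : E n, besselKernel n x = 1 := by
  rw [integral_congr_ae (ae_besselKernel_eq hn),
    integral_integral_swap (f := fun (x : E n) s => dampedHeat n 1 4 (x, s))
      (integrable_dampedHeat one_pos four_pos),
    setIntegral_congr_fun (g := fun s => exp (-s)) measurableSet_Ioi fun s hs => ?_]
  · simpa using integral_exp_neg_Ioi 0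
  · simp [integral_dampedHeat (n := n) (c := 1) four_pos (show (0 : ℝ) < s from hs)]

/-- Half of the damping `e^(-s)` and half of the Gaussian exponent pay for the factor `e^(|x|/2)`.
What remains is a damped heat kernel with `c = 1/2`, `b = 8`, which is still integrable in space and
time. -/
theorem integrable_exp_mul_besselKernel (hn : 1 ≤ n) :
    Integrable (fun x : E n => exp (‖x‖ / 2) * besselKernel n x) := by
  have h : Integrable (fun q : E n × ℝ => exp (‖q.1‖ / 2) * dampedHeat n 1 4 q)
      (volume.prod (volume.restrict (Ioi (0 : ℝ)))) := by
    refine (integrable_dampedHeat (n := n) (c := 1 / 2) (b := 8) (by norm_num)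
      (by norm_num)).mono' ?_ ?_
    · have := measurable_dampedHeat (n := n) 1 4
      exact Measurable.aestronglyMeasurable (by fun_prop)
    · have hm : MeasurableSet {q : E n × ℝ | ‖exp (‖q.1‖ / 2) * dampedHeat n 1 4 q‖ ≤
          dampedHeat n (1 / 2) 8 q} := by
        have := measurable_dampedHeat (n := n) 1 4
        have := measurable_dampedHeat (n := n) (1 / 2) 8
        exact measurableSet_le (by fun_prop) (by fun_prop)
      refine (Measure.ae_prod_iff_ae_ae hm).2 (Eventually.of_forall fun z => ?_)
      refine (ae_restrict_iff' measurableSet_Ioi).2 (Eventually.of_forall fun s hs => ?_)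
      have hs : 0 < s := hs
      rw [Real.norm_of_nonneg (mul_nonneg (exp_pos _).le (dampedHeat_nonneg 1 4 hs))]
      unfold dampedHeat
      have key : exp (‖z‖ / 2) * exp (-(1 * s)) * exp (-(‖z‖ ^ 2 / (4 * s))) ≤
          exp (-(1 / 2 * s)) * exp (-(‖z‖ ^ 2 / (8 * s))) := by
        rw [← exp_add, ← exp_add, ← exp_add]
        refine exp_le_exp.2 ?_
        have : ‖z‖ ^ 2 / (4 * s) - ‖z‖ ^ 2 / (8 * s) + s / 2 - ‖z‖ / 2 =
            (‖z‖ - 2 * s) ^ 2 / (8 * s) := by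
          field_simp; ring
        have : 0 ≤ (‖z‖ - 2 * s) ^ 2 / (8 * s) := by positivity
        linarith
      simp only
      calc _ = (4 * π * s) ^ (-((n : ℝ) / 2)) *
            (exp (‖z‖ / 2) * exp (-(1 * s)) * exp (-(‖z‖ ^ 2 / (4 * s)))) := by ring
        _ ≤ (4 * π * s) ^ (-((n : ℝ) / 2)) *
            (exp (-(1 / 2 * s)) * exp (-(‖z‖ ^ 2 / (8 * s)))) := by gcongr
        _ = _ := by ring
  have h' := h.integral_prod_left
  refine h'.congr ?_
  filter_upwards [ae_besselKernel_eq hn] with x hx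
  rw [hx, ← integral_const_mul]

theorem integrable_besselKernel (hn : 1 ≤ n) : Integrable (besselKernel n) := by
  refine (integrable_exp_mul_besselKernel hn).mono' measurable_besselKernel.aestronglyMeasurable
    (Eventually.of_forall fun x => ?_)
  rw [Real.norm_of_nonneg (besselKernel_nonneg x)]
  exact le_mul_of_one_le_left (besselKernel_nonneg x) (one_le_exp (by positivity))

/-- The Bessel kernel decays at most exponentially. -/
theorem exists_exp_le_besselKernel (hn : 1 ≤ n) :
    ∃ c M : ℝ, 0 < c ∧ 0 < M ∧ ∀ᵐ x : E n, c * exp (-(M * ‖x‖)) ≤ besselKernel n x := by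
  refine ⟨exp (-2) * (8 * π) ^ (-((n : ℝ) / 2)), 1 + (n : ℝ) / 4 + 1 / 4, by positivity,
    by positivity, ?_⟩
  filter_upwards [ae_besselKernel_eq hn,
    (integrable_dampedHeat (n := n) one_pos four_pos).prod_right_ae] with x hx hi
  rw [hx]
  set r := ‖x‖ with hr
  have hr0 : 0 ≤ r := norm_nonneg x
  have hsub : Ioc (r + 1) (r + 2) ⊆ Ioi (0 : ℝ) := fun s hs => by
    have := hs.1
    exact lt_trans (by positivity) this
  -- Only times in a unit window near `s = r` are kept. There `e^(-s) ≥ e^(-2-r)`, `r²/(4s) ≤ r/4`,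
  -- and `s ≤ r + 2 ≤ 2 e^(r/2)` bounds the power of `s`; these give the three parts of the decay
  -- rate.
  calc _ = ∫ s in Ioc (r + 1) (r + 2), exp (-2) * (8 * π) ^ (-((n : ℝ) / 2)) *
        exp (-((1 + (n : ℝ) / 4 + 1 / 4) * r)) := by
        rw [setIntegral_const]; simp [Measure.real]; norm_num
    _ ≤ ∫ s in Ioc (r + 1) (r + 2), dampedHeat n 1 4 (x, s) := by
        refine setIntegral_mono_on (integrableOn_const (by simp)) (IntegrableOn.mono_set hi hsub)
          measurableSet_Ioc fun s hs => ?_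
        have hs0 : 0 < s := hsub hs
        have h1 : exp (-2) * exp (-r) ≤ exp (-(1 * s)) := by
          rw [← exp_add]; exact exp_le_exp.2 (by linarith [hs.2])
        have h2 : (8 * π) ^ (-((n : ℝ) / 2)) * exp (-((n : ℝ) / 4 * r)) ≤
            (4 * π * s) ^ (-((n : ℝ) / 2)) := by
          have e : exp (-((n : ℝ) / 4 * r)) = (exp (r / 2)) ^ (-((n : ℝ) / 2)) := by
            rw [← exp_mul]; congr 1; ring
          rw [e, ← Real.mul_rpow (by positivity) (exp_pos _).le]
          refine Real.rpow_le_rpow_of_nonpos (by positivity) ?_ (by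
            have : (0 : ℝ) ≤ n := Nat.cast_nonneg n
            linarith)
          have := add_one_le_exp (r / 2)
          have hs2 := hs.2
          nlinarith [Real.pi_pos]
        have h3 : exp (-(1 / 4 * r)) ≤ exp (-(r ^ 2 / (4 * s))) := by
          refine exp_le_exp.2 (neg_le_neg ?_)
          rw [div_le_iff₀ (by positivity)]
          nlinarith [hs.1]
        have e : exp (-((1 + (n : ℝ) / 4 + 1 / 4) * r)) =
            exp (-r) * exp (-((n : ℝ) / 4 * r)) * exp (-(1 / 4 * r)) := by
          rw [← exp_add, ← exp_add]; congr 1; ring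
        rw [e]
        unfold dampedHeat
        calc _ = (exp (-2) * exp (-r)) * (((8 * π) ^ (-((n : ℝ) / 2)) * exp (-((n : ℝ) / 4 * r))) *
              exp (-(1 / 4 * r))) := by ring
          _ ≤ _ := by gcongr
    _ ≤ _ := setIntegral_mono_set hi
        ((ae_restrict_iff' measurableSet_Ioi).2 (Eventually.of_forall fun s hs =>
          dampedHeat_nonneg 1 4 hs)) hsub.eventuallyLE

/-! ### The Bessel potential operator on functions of polynomial growth -/

/-- The weight `(R² + |x|²)^(a/2)`. -/
def weight (R a : ℝ) (x : E n) : ℝ := (R ^ 2 + ‖x‖ ^ 2) ^ (a / 2)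

theorem one_le_weight {R a : ℝ} (hR : 1 ≤ R) (ha : 0 ≤ a) (x : E n) : 1 ≤ weight R a x :=
  Real.one_le_rpow (by nlinarith [sq_nonneg ‖x‖]) (by positivity)

theorem weight_pos {R a : ℝ} (hR : 1 ≤ R) (ha : 0 ≤ a) (x : E n) : 0 < weight R a x :=
  one_pos.trans_le (one_le_weight hR ha x)

theorem continuous_weight {R a : ℝ} (ha : 0 ≤ a) : Continuous (weight (n := n) R a) := by
  unfold weight
  exact Continuous.rpow_const (by fun_prop) fun x => Or.inr (by positivity)

theorem norm_rpow_le_weight {R a d : ℝ} (hR : 1 ≤ R) (hd : 0 ≤ d) (hda : d ≤ a) (x : E n) :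
    ‖x‖ ^ d ≤ weight R a x := by
  have h1 : ‖x‖ ^ d = (‖x‖ ^ 2) ^ (d / 2) := by
    rw [← Real.rpow_natCast, ← Real.rpow_mul (norm_nonneg x)]; congr 1; push_cast; ring
  rw [h1]
  calc (‖x‖ ^ 2) ^ (d / 2) ≤ (R ^ 2 + ‖x‖ ^ 2) ^ (d / 2) := by
        gcongr; nlinarith
    _ ≤ _ := Real.rpow_le_rpow_of_exponent_le (by nlinarith [sq_nonneg ‖x‖]) (by linarith)

theorem weight_mono_radius {R R' a : ℝ} (hR : 0 ≤ R) (h : R ≤ R') (ha : 0 ≤ a) (x : E n) :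
    weight R a x ≤ weight R' a x := by
  unfold weight; gcongr

/-- A translation costs only the rate `a/R`, which is small for large `R`. This is why the weight
carries a free radius. -/
theorem weight_sub_le {R a : ℝ} (hR : 1 ≤ R) (ha : 0 ≤ a) (x z : E n) :
    weight R a (x - z) ≤ exp (a / R * ‖z‖) * weight R a x := by
  have hR0 : 0 < R := by linarith
  have h1 : R ^ 2 + ‖x - z‖ ^ 2 ≤ exp (‖z‖ / R) ^ 2 * (R ^ 2 + ‖x‖ ^ 2) := by
    have e1 : 1 + ‖z‖ / R ≤ exp (‖z‖ / R) := by linarith [add_one_le_exp (‖z‖ / R)]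
    have e2 : ‖x - z‖ ≤ ‖x‖ + ‖z‖ := norm_sub_le x z
    calc R ^ 2 + ‖x - z‖ ^ 2 ≤ R ^ 2 + (‖x‖ + ‖z‖) ^ 2 := by gcongr
      _ ≤ (1 + ‖z‖ / R) ^ 2 * (R ^ 2 + ‖x‖ ^ 2) := by
          -- Completing the square absorbs the cross term `-2 ‖x‖ ‖z‖`.
          have e3 : (1 + ‖z‖ / R) ^ 2 * (R ^ 2 + ‖x‖ ^ 2) - (R ^ 2 + (‖x‖ + ‖z‖) ^ 2) =
              2 * ‖z‖ / R * (R - ‖x‖ / 2) ^ 2 + 3 / 2 * ‖z‖ * ‖x‖ ^ 2 / R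
                + ‖z‖ ^ 2 * ‖x‖ ^ 2 / R ^ 2 := by
            field_simp; ring
          have : 0 ≤ 2 * ‖z‖ / R * (R - ‖x‖ / 2) ^ 2 + 3 / 2 * ‖z‖ * ‖x‖ ^ 2 / R
                + ‖z‖ ^ 2 * ‖x‖ ^ 2 / R ^ 2 := by positivity
          linarith
      _ ≤ _ := by gcongr
  unfold weight
  calc _ ≤ (exp (‖z‖ / R) ^ 2 * (R ^ 2 + ‖x‖ ^ 2)) ^ (a / 2) := by gcongr
    _ = _ := by
      rw [Real.mul_rpow (by positivity) (by positivity), ← exp_nat_mul, ← exp_mul]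
      congr 2
      push_cast; field_simp

theorem besselOp_eq (φ : E n → ℝ) (x : E n) :
    besselOp φ x = ∫ z : E n, besselKernel n z * φ (x - z) := by
  unfold besselOp
  rw [← integral_sub_left_eq_self (fun z => besselKernel n z * φ (x - z)) volume x]
  simp

theorem integrable_exp_smul_besselKernel (hn : 1 ≤ n) {δ : ℝ} (hδ : δ ≤ 1 / 2) :
    Integrable (fun z : E n => exp (δ * ‖z‖) * besselKernel n z) := by
  refine (integrable_exp_mul_besselKernel hn).mono' ?_ (Eventually.of_forall fun x => ?_)
  · have := measurable_besselKernel (n := n)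
    exact Measurable.aestronglyMeasurable (by fun_prop)
  · rw [Real.norm_of_nonneg (mul_nonneg (exp_pos _).le (besselKernel_nonneg x))]
    refine mul_le_mul_of_nonneg_right (exp_le_exp.2 ?_) (besselKernel_nonneg x)
    nlinarith [norm_nonneg x]

theorem integrable_besselKernel_mul_weight (hn : 1 ≤ n) {R a : ℝ} (hR : 1 ≤ R) (ha : 0 ≤ a)
    (haR : 2 * a ≤ R) (x : E n) :
    Integrable (fun z : E n => besselKernel n z * weight R a (x - z)) := by
  have hR0 : 0 < R := by linarith
  have hδ : a / R ≤ 1 / 2 := by rw [div_le_iff₀ hR0]; linarith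
  refine ((integrable_exp_smul_besselKernel hn hδ).mul_const (weight R a x)).mono' ?_
    (Eventually.of_forall fun z => ?_)
  · have := measurable_besselKernel (n := n)
    have := (continuous_weight (n := n) (R := R) ha).measurable
    exact Measurable.aestronglyMeasurable (by fun_prop)
  · rw [Real.norm_of_nonneg (mul_nonneg (besselKernel_nonneg z) (weight_pos hR ha _).le)]
    have := mul_le_mul_of_nonneg_left (weight_sub_le hR ha x z) (besselKernel_nonneg z)
    linarith

theorem integrable_besselKernel_mul (hn : 1 ≤ n) {R a C : ℝ} (hR : 1 ≤ R) (ha : 0 ≤ a)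
    (haR : 2 * a ≤ R) {φ : E n → ℝ} (hφ : Measurable φ) (hC : ∀ y, |φ y| ≤ C * weight R a y)
    (x : E n) : Integrable (fun y : E n => besselKernel n (x - y) * φ y) := by
  have h := ((integrable_besselKernel_mul_weight hn hR ha haR x).comp_sub_left x).const_mul C
  refine h.mono' ?_ (Eventually.of_forall fun y => ?_)
  · have := measurable_besselKernel (n := n)
    exact Measurable.aestronglyMeasurable (by fun_prop)
  · rw [norm_mul, Real.norm_of_nonneg (besselKernel_nonneg _), Real.norm_eq_abs,
      sub_sub_cancel]
    have := mul_le_mul_of_nonneg_left (hC y) (besselKernel_nonneg (x - y))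
    linarith

/-- The exponential moment of the Bessel kernel. -/
def expMoment (n : ℕ) (δ : ℝ) : ℝ := ∫ z : E n, exp (δ * ‖z‖) * besselKernel n z

theorem expMoment_nonneg (δ : ℝ) : 0 ≤ expMoment n δ :=
  integral_nonneg fun z => mul_nonneg (exp_pos _).le (besselKernel_nonneg z)

theorem besselOp_weight_le (hn : 1 ≤ n) {R a : ℝ} (hR : 1 ≤ R) (ha : 0 ≤ a)
    (haR : 2 * a ≤ R) (x : E n) :
    besselOp (weight R a) x ≤ expMoment n (a / R) * weight R a x := by
  have hR0 : 0 < R := by linarith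
  have hδ : a / R ≤ 1 / 2 := by rw [div_le_iff₀ hR0]; linarith
  rw [besselOp_eq, expMoment, ← integral_mul_const]
  refine integral_mono (integrable_besselKernel_mul_weight hn hR ha haR x)
    ((integrable_exp_smul_besselKernel hn hδ).mul_const _) fun z => ?_
  have := mul_le_mul_of_nonneg_left (weight_sub_le hR ha x z) (besselKernel_nonneg z)
  simp only
  linarith

/-- By dominated convergence the moment tends to the total mass `1` of the kernel as `R → ∞`. With
`besselOp_weight_le`, `𝓑` is then almost a contraction in the weighted norm. -/
theorem exists_expMoment_le (hn : 1 ≤ n) (a : ℝ) {κ : ℝ} (hκ : 1 < κ) :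
    ∃ R : ℝ, 1 ≤ R ∧ 2 * a ≤ R ∧ expMoment n (a / R) ≤ κ := by
  have h : Tendsto (fun R : ℝ => expMoment n (a / R)) atTop (𝓝 1) := by
    rw [← integral_besselKernel hn]
    have h0 : Tendsto (fun R : ℝ => a / R) atTop (𝓝 0) := tendsto_const_nhds.div_atTop tendsto_id
    refine tendsto_integral_filter_of_dominated_convergence
      (fun x => exp (‖x‖ / 2) * besselKernel n x) ?_ ?_ (integrable_exp_mul_besselKernel hn) ?_
    · have := measurable_besselKernel (n := n)
      exact Eventually.of_forall fun R => Measurable.aestronglyMeasurable (by fun_prop)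
    · filter_upwards [h0.eventually_le_const (show (0 : ℝ) < 1 / 2 by norm_num)] with R hR
      refine Eventually.of_forall fun x => ?_
      rw [Real.norm_of_nonneg (mul_nonneg (exp_pos _).le (besselKernel_nonneg x))]
      refine mul_le_mul_of_nonneg_right (exp_le_exp.2 ?_) (besselKernel_nonneg x)
      nlinarith [norm_nonneg x]
    · refine Eventually.of_forall fun x => ?_
      have : Tendsto (fun R : ℝ => exp (a / R * ‖x‖) * besselKernel n x) atTop
          (𝓝 (exp (0 * ‖x‖) * besselKernel n x)) :=
        ((continuous_exp.tendsto _).comp (h0.mul_const _)).mul_const _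
      simpa using this
  obtain ⟨R, h1, h2, h3⟩ := ((h.eventually_le_const hκ).and
    ((eventually_ge_atTop 1).and (eventually_ge_atTop (2 * a)))).exists
  exact ⟨R, h2, h3, h1⟩

theorem besselOp_mono {φ ψ : E n → ℝ} {x : E n}
    (hφ : Integrable (fun y : E n => besselKernel n (x - y) * φ y))
    (hψ : Integrable (fun y : E n => besselKernel n (x - y) * ψ y)) (h : ∀ᵐ y, φ y ≤ ψ y) :
    besselOp φ x ≤ besselOp ψ x := by
  refine integral_mono_ae hφ hψ ?_
  filter_upwards [h] with y hy using mul_le_mul_of_nonneg_left hy (besselKernel_nonneg _)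

theorem besselOp_nonneg {φ : E n → ℝ} (h : ∀ y, 0 ≤ φ y) (x : E n) : 0 ≤ besselOp φ x :=
  integral_nonneg fun y => mul_nonneg (besselKernel_nonneg _) (h y)

theorem besselOp_const_mul (c : ℝ) (φ : E n → ℝ) (x : E n) :
    besselOp (fun y => c * φ y) x = c * besselOp φ x := by
  unfold besselOp
  rw [← integral_const_mul]
  congr 1; ext y; ring

/-! ### Lower bounds -/

/-- Half of the mass of the Bessel kernel on the shell `1 ≤ |z| ≤ 2`. -/
def shellMass (n : ℕ) : ℝ := (1 / 2) * ∫ z in {z : E n | 1 ≤ ‖z‖ ∧ ‖z‖ ≤ 2}, besselKernel n z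

theorem measurableSet_shell : MeasurableSet {z : E n | 1 ≤ ‖z‖ ∧ ‖z‖ ≤ 2} :=
  (measurableSet_le measurable_const measurable_norm).inter
    (measurableSet_le measurable_norm measurable_const)

theorem shellMass_pos (hn : 1 ≤ n) : 0 < shellMass n := by
  obtain ⟨c, M, hc, hM, hK⟩ := exists_exp_le_besselKernel hn
  have hfin : volume {z : E n | 1 ≤ ‖z‖ ∧ ‖z‖ ≤ 2} < ⊤ := by
    refine (measure_mono (t := Metric.closedBall 0 2) fun z hz => ?_).trans_lt
      measure_closedBall_lt_top
    simpa using hz.2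
  have hpos : 0 < volume {z : E n | 1 ≤ ‖z‖ ∧ ‖z‖ ≤ 2} := by
    have hopen : IsOpen {z : E n | 1 < ‖z‖ ∧ ‖z‖ < 2} :=
      (isOpen_lt continuous_const continuous_norm).inter (isOpen_lt continuous_norm continuous_const)
    have := nontrivial_E hn
    obtain ⟨z, hz⟩ := exists_norm_eq (E n) (show (0 : ℝ) ≤ 3 / 2 by norm_num)
    refine (hopen.measure_pos volume ⟨z, ?_⟩).trans_le (measure_mono fun z hz => ⟨hz.1.le, hz.2.le⟩)
    change 1 < ‖z‖ ∧ ‖z‖ < 2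
    rw [hz]; norm_num
  have : c * exp (-(M * 2)) * (volume {z : E n | 1 ≤ ‖z‖ ∧ ‖z‖ ≤ 2}).toReal ≤
      ∫ z in {z : E n | 1 ≤ ‖z‖ ∧ ‖z‖ ≤ 2}, besselKernel n z := by
    calc _ = ∫ z in {z : E n | 1 ≤ ‖z‖ ∧ ‖z‖ ≤ 2}, c * exp (-(M * 2)) := by
          rw [setIntegral_const]; simp [Measure.real, mul_comm]
      _ ≤ _ := by
          refine setIntegral_mono_on_ae (integrableOn_const hfin.ne)
            (integrable_besselKernel hn).integrableOn measurableSet_shell ?_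
          filter_upwards [hK] with z hz hz'
          refine le_trans ?_ hz
          gcongr
          exact hz'.2
  have h2 : 0 < (volume {z : E n | 1 ≤ ‖z‖ ∧ ‖z‖ ≤ 2}).toReal :=
    ENNReal.toReal_pos hpos.ne' hfin.ne
  unfold shellMass
  have : 0 < c * exp (-(M * 2)) * (volume {z : E n | 1 ≤ ‖z‖ ∧ ‖z‖ ≤ 2}).toReal := by positivity
  linarith

/-- The kernel is even, so at least half of its shell mass lies where `⟨x, z⟩ ≤ 0`. On that half `|x
- z|² ≥ |x|² + |z|²`, so `x - z` lies outside the unit ball and no nearer to the origin than `x`;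
this is how a bound on `V` for `|x| ≥ 1` only can be used at every `x`. -/
theorem shellMass_mul_le_besselOp (hn : 1 ≤ n) {f : E n → ℝ} {x : E n} {L : ℝ}
    (hf : ∀ y, 0 ≤ f y) (hi : Integrable (fun y : E n => besselKernel n (x - y) * f y))
    (hL0 : 0 ≤ L)
    (hL : ∀ z : E n, 1 ≤ ‖z‖ → ‖z‖ ≤ 2 → inner ℝ x z ≤ 0 → L ≤ f (x - z)) :
    shellMass n * L ≤ besselOp f x := by
  set S : Set (E n) := {z : E n | 1 ≤ ‖z‖ ∧ ‖z‖ ≤ 2} with hS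
  set A : Set (E n) := S ∩ {z | inner ℝ x z ≤ 0} with hA
  have hinner : Continuous fun z : E n => (inner ℝ x z : ℝ) := by fun_prop
  have hAm : MeasurableSet A :=
    measurableSet_shell.inter (measurableSet_le hinner.measurable measurable_const)
  have hK := integrable_besselKernel hn
  have hhalf : shellMass n ≤ ∫ z in A, besselKernel n z := by
    have hneg : ∫ z in Neg.neg ⁻¹' A, besselKernel n z = ∫ z in A, besselKernel n z := by
      have := (Measure.measurePreserving_neg (volume : Measure (E n))).setIntegral_preimage_emb
        (MeasurableEquiv.neg (E n)).measurableEmbedding (besselKernel n) A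
      rw [← this]
      exact setIntegral_congr_fun (hAm.preimage measurable_neg)
        fun z _ => besselKernel_congr (norm_neg z).symm
    have hsub : S ⊆ A ∪ Neg.neg ⁻¹' A := fun z hz => by
      rcases le_total (inner ℝ x z : ℝ) 0 with h | h
      · exact Or.inl ⟨hz, h⟩
      · refine Or.inr ⟨?_, ?_⟩
        · simpa [hS] using hz
        · simpa using h
    have h1 : ∫ z in S, besselKernel n z ≤ ∫ z in A ∪ Neg.neg ⁻¹' A, besselKernel n z :=
      setIntegral_mono_set hK.integrableOn (Eventually.of_forall besselKernel_nonneg)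
        hsub.eventuallyLE
    have h2 : ∫ z in A ∪ Neg.neg ⁻¹' A, besselKernel n z ≤
        (∫ z in A, besselKernel n z) + ∫ z in Neg.neg ⁻¹' A, besselKernel n z :=
by
      rw [← union_sdiff_self, setIntegral_union disjoint_sdiff_right
        ((hAm.preimage measurable_neg).diff hAm) hK.integrableOn hK.integrableOn]
      exact add_le_add le_rfl (setIntegral_mono_set hK.integrableOn
        (Eventually.of_forall besselKernel_nonneg)
        (sdiff_subset (s := Neg.neg ⁻¹' A) (t := A)).eventuallyLE)
    unfold shellMass
    linarith
  have hi' : Integrable (fun z : E n => besselKernel n z * f (x - z)) := by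
    simpa using hi.comp_sub_left x
  calc shellMass n * L ≤ (∫ z in A, besselKernel n z) * L := by gcongr
    _ = ∫ z in A, besselKernel n z * L := (integral_mul_const _ _).symm
    _ ≤ ∫ z in A, besselKernel n z * f (x - z) := by
        refine setIntegral_mono_on (hK.mul_const L).integrableOn hi'.integrableOn hAm fun z hz => ?_
        exact mul_le_mul_of_nonneg_left (hL z hz.1.1 hz.1.2 hz.2) (besselKernel_nonneg z)
    _ ≤ ∫ z, besselKernel n z * f (x - z) := setIntegral_le_integral hi'
        (Eventually.of_forall fun z => mul_nonneg (besselKernel_nonneg z) (hf _))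
    _ = besselOp f x := (besselOp_eq f x).symm

theorem norm_le_norm_sub_of_inner_nonpos {x z : E n} (h : inner ℝ x z ≤ 0) :
    ‖x‖ ^ 2 + ‖z‖ ^ 2 ≤ ‖x - z‖ ^ 2 := by
  rw [norm_sub_sq_real]; linarith

/-! ### Powers of the norm are subsolutions: `|x|^s ≤ 𝓑 |·|^s` for `s ∈ J_n⁺` -/

theorem measurable_norm_rpow (s : ℝ) : Measurable (fun y : E n => ‖y‖ ^ s) := by fun_prop

theorem integrable_besselKernel_mul_norm_rpow (hn : 1 ≤ n) {s : ℝ} (hs : 0 ≤ s) (x : E n) :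
    Integrable (fun y : E n => besselKernel n (x - y) * ‖y‖ ^ s) := by
  refine integrable_besselKernel_mul hn (R := max 1 (2 * s)) (a := s) (C := 1) (le_max_left _ _) hs
    (le_max_right _ _) (measurable_norm_rpow s) (fun y => ?_) x
  rw [abs_of_nonneg (by positivity), one_mul]
  exact norm_rpow_le_weight (le_max_left _ _) hs le_rfl y

/-- For `s ≥ 1` the function `|·|^s` is convex; averaging the contributions of `z` and `-z` gives
the claim. This serves dimension one, where a nonzero `s ∈ J_1⁺` is at least `1`. -/
theorem norm_rpow_le_besselOp_of_one_le (hn : 1 ≤ n) {s : ℝ} (hs : 1 ≤ s) (x : E n) :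
    ‖x‖ ^ s ≤ besselOp (fun y : E n => ‖y‖ ^ s) x := by
  have h1 : Integrable (fun z : E n => besselKernel n z * ‖x - z‖ ^ s) := by
    simpa using (integrable_besselKernel_mul_norm_rpow hn (by linarith) x).comp_sub_left x
  have e2 : ∀ z : E n, besselKernel n (-z) * ‖x - -z‖ ^ s = besselKernel n z * ‖x + z‖ ^ s :=
    fun z => by rw [besselKernel_congr (norm_neg z), sub_neg_eq_add]
  have h2 : Integrable (fun z : E n => besselKernel n z * ‖x + z‖ ^ s) := by
    simpa only [e2] using h1.comp_neg
  have h3 : besselOp (fun y : E n => ‖y‖ ^ s) x = ∫ z : E n, besselKernel n z * ‖x + z‖ ^ s := by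
    rw [besselOp_eq, ← integral_neg_eq_self]
    simp only [e2]
  have h4 : ‖x‖ ^ s * 2 ≤ besselOp (fun y : E n => ‖y‖ ^ s) x +
      besselOp (fun y : E n => ‖y‖ ^ s) x := by
    nth_rewrite 2 [h3]
    rw [besselOp_eq, ← integral_add h1 h2]
    calc ‖x‖ ^ s * 2 = ∫ z : E n, besselKernel n z * (‖x‖ ^ s * 2) := by
          rw [integral_mul_const, integral_besselKernel hn, one_mul]
      _ ≤ _ := by
        refine integral_mono ((integrable_besselKernel hn).mul_const _) (h1.add h2) fun z => ?_
        simp only [← mul_add]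
        refine mul_le_mul_of_nonneg_left ?_ (besselKernel_nonneg z)
        have hc := (convexOn_rpow hs).2 (norm_nonneg (x - z)) (norm_nonneg (x + z))
          (show (0 : ℝ) ≤ 1 / 2 by norm_num) (show (0 : ℝ) ≤ 1 / 2 by norm_num) (by norm_num)
        simp only [smul_eq_mul] at hc
        have ht : ‖x‖ ≤ 1 / 2 * ‖x - z‖ + 1 / 2 * ‖x + z‖ := by
          have : ‖(2 : ℝ) • x‖ ≤ ‖x - z‖ + ‖x + z‖ := by
            calc ‖(2 : ℝ) • x‖ = ‖(x - z) + (x + z)‖ := by congr 1; rw [two_smul]; abel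
              _ ≤ _ := norm_add_le _ _
          rw [norm_smul, Real.norm_ofNat] at this
          linarith
        have := Real.rpow_le_rpow (norm_nonneg x) ht (by linarith : 0 ≤ s)
        linarith
  linarith

/-- The power `|·|^s` satisfies the sub-mean value inequality on circles in the plane. -/
theorem rpow_le_integral_norm_sub_circle {s r : ℝ} (hs : 0 < s) (hr : 0 < r) (w : ℂ) :
    2 * π * r ^ s ≤
      ∫ θ in (0 : ℝ)..(2 * π), ‖(r : ℂ) - w * Complex.exp (θ * Complex.I)‖ ^ s := by
  by_cases hw : w = 0
  · simp [hw, abs_of_pos hr]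
  have hw0 : 0 < ‖w‖ := norm_pos_iff.2 hw
  set a : ℂ := r / w with ha
  have hcm : ∀ θ : ℝ, circleMap 0 1 θ = Complex.exp (θ * Complex.I) := fun θ => by
    simp [circleMap]
  have hnorm : ∀ θ : ℝ, ‖(r : ℂ) - w * Complex.exp (θ * Complex.I)‖ =
      ‖w‖ * ‖circleMap 0 1 θ - a‖ := fun θ => by
    rw [hcm, ← norm_mul, mul_sub, ha, mul_div_cancel₀ _ hw, norm_sub_rev]
  have hlog : IntervalIntegrable (fun θ => log ‖circleMap 0 1 θ - a‖) volume 0 (2 * π) :=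
    circleIntegrable_log_norm_sub_const 1
  -- Jensen's formula: the circle average of `log |ζ - a|` is `log⁺ |a|`, which is at least `log
  -- |a|`.
  have hmean : (2 * π) * (log r - log ‖w‖) ≤ ∫ θ in (0 : ℝ)..(2 * π), log ‖circleMap 0 1 θ - a‖ := by
    have h := circleAverage_log_norm_sub_const_eq_posLog (a := a)
    rw [circleAverage, smul_eq_mul, inv_mul_eq_iff_eq_mul₀ (by positivity)] at h
    rw [h]
    gcongr
    have : log ‖a‖ = log r - log ‖w‖ := by
      rw [ha, norm_div, log_div (by simpa using hr.ne') hw0.ne']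
      simp
    rw [← this]
    exact le_max_right _ _
  have hcont : Continuous fun θ : ℝ => ‖(r : ℂ) - w * Complex.exp (θ * Complex.I)‖ ^ s :=
    Continuous.rpow_const (by fun_prop) fun _ => Or.inr hs.le
  have hae : ∀ᵐ θ : ℝ, circleMap 0 1 θ ≠ a := by
    have := ((countable_singleton a).preimage_circleMap 0 one_ne_zero).ae_notMem volume
    filter_upwards [this] with θ hθ using hθ
  have hrs : 0 < r ^ s := Real.rpow_pos_of_pos hr s
  have hint : IntervalIntegrable (fun θ => r ^ s * (1 + s * (log ‖w‖ - log r)) +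
      r ^ s * s * log ‖circleMap 0 1 θ - a‖) volume 0 (2 * π) :=
    intervalIntegrable_const.add (hlog.const_mul _)
  -- The tangent inequality `e^y ≥ 1 + y` at the value `r^s` passes from the mean of the logarithm
  -- to the mean of the power.
  calc 2 * π * r ^ s ≤ ∫ θ in (0 : ℝ)..(2 * π), (r ^ s * (1 + s * (log ‖w‖ - log r)) +
        r ^ s * s * log ‖circleMap 0 1 θ - a‖) := by
        rw [intervalIntegral.integral_add intervalIntegrable_const (hlog.const_mul _),
          intervalIntegral.integral_const, intervalIntegral.integral_const_mul, smul_eq_mul]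
        have := mul_le_mul_of_nonneg_left hmean (show 0 ≤ r ^ s * s by positivity)
        linarith
    _ ≤ _ := by
        refine intervalIntegral.integral_mono_ae (by positivity) hint
          (hcont.intervalIntegrable _ _) ?_
        filter_upwards [hae] with θ hθ
        have hpos : 0 < ‖circleMap 0 1 θ - a‖ := norm_pos_iff.2 (sub_ne_zero.2 hθ)
        rw [hnorm]
        set t := ‖circleMap 0 1 θ - a‖ with ht
        have e : (‖w‖ * t) ^ s = r ^ s * exp (s * (log ‖w‖ + log t - log r)) := by
          rw [Real.rpow_def_of_pos (by positivity), Real.rpow_def_of_pos hr, ← exp_add,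
            log_mul hw0.ne' hpos.ne']
          congr 1; ring
        rw [e]
        have := mul_le_mul_of_nonneg_left
          (add_one_le_exp (s * (log ‖w‖ + log t - log r))) hrs.le
        linarith

theorem exists_unit_orthogonal (hn : 2 ≤ n) (x : E n) : ∃ e : E n, ‖e‖ = 1 ∧ inner ℝ x e = 0 := by
  have hne : (ℝ ∙ x)ᗮ ≠ ⊥ := fun h => by
    rw [Submodule.orthogonal_eq_bot_iff] at h
    have h1 := finrank_span_le_card (R := ℝ) ({x} : Set (E n))
    rw [h, finrank_top] at h1
    simp at h1
    omega
  obtain ⟨y, hy, hy0⟩ := Submodule.exists_mem_ne_zero_of_ne_bot hne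
  refine ⟨(‖y‖)⁻¹ • y, norm_smul_inv_norm (𝕜 := ℝ) hy0, ?_⟩
  rw [inner_smul_right, Submodule.mem_orthogonal_singleton_iff_inner_right.1 hy, mul_zero]

theorem norm_le_of_orthonormal_pair {e₁ e₂ : E n} (h₁ : ‖e₁‖ = 1) (h₂ : ‖e₂‖ = 1)
    (h : inner ℝ e₁ e₂ = 0) (y : E n) :
    ‖(⟨inner ℝ e₁ y, inner ℝ e₂ y⟩ : ℂ)‖ ≤ ‖y‖ := by
  rw [← sq_le_sq₀ (norm_nonneg _) (norm_nonneg _), Complex.sq_norm, Complex.normSq_mk]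
  have := Orthonormal.sum_inner_products_le (𝕜 := ℝ) (v := ![e₁, e₂]) y (s := Finset.univ) (by
    rw [orthonormal_iff_ite]
    intro i j
    fin_cases i <;> fin_cases j <;> simp [h₁, h₂, h, real_inner_comm e₁ e₂])
  simp [Fin.sum_univ_two] at this
  nlinarith

/-- The kernel is radial, so `z` may be replaced by its image under any isometry, and one may
average over a circle of isometries moving a plane through `x`. Projecting onto that plane shortens
`x - S θ z`, and the planar circle inequality finishes the proof without differentiating `|x|^s`. -/
theorem norm_rpow_le_besselOp_of_two_le (hn : 2 ≤ n) {s : ℝ} (hs : 0 < s) (x : E n) :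
    ‖x‖ ^ s ≤ besselOp (fun y : E n => ‖y‖ ^ s) x := by
  have hn1 : 1 ≤ n := by omega
  by_cases hx : x = 0
  · rw [hx, norm_zero, Real.zero_rpow hs.ne']
    exact besselOp_nonneg (fun y => by positivity) _
  set r := ‖x‖ with hr
  have hr0 : 0 < r := norm_pos_iff.2 hx
  obtain ⟨e₂, he₂, hxe⟩ := exists_unit_orthogonal hn x
  set e₁ : E n := r⁻¹ • x with he₁
  have hx1 : x = r • e₁ := by rw [he₁, smul_smul, mul_inv_cancel₀ hr0.ne', one_smul]
  have h₁ : ‖e₁‖ = 1 := norm_smul_inv_norm (𝕜 := ℝ) hx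
  have h12 : inner ℝ e₁ e₂ = 0 := by rw [he₁, inner_smul_left, hxe, mul_zero]
  have h21 : inner ℝ e₂ e₁ = 0 := by rw [real_inner_comm, h12]
  have h11 : inner ℝ e₁ e₁ = 1 := by rw [real_inner_self_eq_norm_sq, h₁]; norm_num
  have h22 : inner ℝ e₂ e₂ = 1 := by rw [real_inner_self_eq_norm_sq, he₂]; norm_num
  -- Half angles, because reflection in the line at angle `θ/2` acts on the plane as `ζ ↦ e^(iθ)
  -- ζ̄`; this explains the conjugate in `hplane`.
  let v : ℝ → E n := fun θ => cos (θ / 2) • e₁ + sin (θ / 2) • e₂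
  have hv : ∀ θ, ‖v θ‖ = 1 := fun θ => by
    have : ‖v θ‖ ^ 2 = 1 := by
      rw [← real_inner_self_eq_norm_sq]
      simp only [v, inner_add_left, inner_add_right, inner_smul_left, inner_smul_right, h12, h21,
        h11, h22]
      simp
      nlinarith [sin_sq_add_cos_sq (θ / 2)]
    nlinarith [norm_nonneg (v θ)]
  let S : ℝ → E n ≃ₗᵢ[ℝ] E n := fun θ => (ℝ ∙ v θ).reflection
  have hS : ∀ θ z, S θ z = (2 * inner ℝ (v θ) z) • v θ - z := fun θ z => by
    simp only [S, Submodule.reflection_singleton_apply, hv]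
    simp [two_smul, two_mul, add_smul]
  have hvc : Continuous v := by fun_prop
  have hSc : Continuous fun q : ℝ × E n => S q.1 q.2 := by
    simp only [hS]; fun_prop
  have hgc : Continuous fun q : ℝ × E n => ‖x - S q.1 q.2‖ ^ s :=
    Continuous.rpow_const (by fun_prop) fun _ => Or.inr hs.le
  have hplane : ∀ (θ : ℝ) (z : E n), ‖(r : ℂ) - (⟨inner ℝ e₁ z, - inner ℝ e₂ z⟩ : ℂ) *
      Complex.exp (θ * Complex.I)‖ ≤ ‖x - S θ z‖ := fun θ z => by
    refine le_trans (le_of_eq ?_) (norm_le_of_orthonormal_pair h₁ he₂ h12 (x - S θ z))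
    congr 1
    have c2 : cos θ = 2 * cos (θ / 2) ^ 2 - 1 := by rw [← cos_two_mul, mul_div_cancel₀ θ two_ne_zero]
    have s2 : sin θ = 2 * sin (θ / 2) * cos (θ / 2) := by rw [← sin_two_mul, mul_div_cancel₀ θ two_ne_zero]
    have sc := sin_sq_add_cos_sq (θ / 2)
    apply Complex.ext
    · simp only [hS, v, hx1, inner_sub_right, inner_add_left, inner_add_right, inner_smul_left,
        inner_smul_right, h12, h11, Complex.sub_re, Complex.mul_re, Complex.exp_ofReal_mul_I_re,
        Complex.exp_ofReal_mul_I_im, Complex.ofReal_re]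
      simp
      rw [c2, s2]; ring
    · simp only [hS, v, hx1, inner_sub_right, inner_add_left, inner_add_right, inner_smul_left,
        inner_smul_right, h21, h22, Complex.sub_im, Complex.mul_im, Complex.exp_ofReal_mul_I_re,
        Complex.exp_ofReal_mul_I_im, Complex.ofReal_im]
      simp
      rw [c2, s2]
      linear_combination (2 * inner ℝ e₂ z) * sc
  set F := besselOp (fun y : E n => ‖y‖ ^ s) x with hF
  have hrot : ∀ θ, F = ∫ z : E n, besselKernel n z * ‖x - S θ z‖ ^ s := fun θ => by
    rw [hF, besselOp_eq, ← (S θ).measurePreserving.integral_comp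
      (S θ).toHomeomorph.measurableEmbedding]
    simp only [besselKernel_congr ((S θ).norm_map _)]
  have hint : Integrable (Function.uncurry fun (θ : ℝ) (z : E n) =>
      besselKernel n z * ‖x - S θ z‖ ^ s)
      ((volume.restrict (Ioc (0 : ℝ) (2 * π))).prod volume) := by
    have hK := measurable_besselKernel (n := n)
    have hw := integrable_besselKernel_mul_weight hn1 (R := max 1 (2 * s)) (a := s)
      (le_max_left _ _) hs.le (le_max_right _ _) (0 : E n)
    have hw2 := (integrable_const (μ := volume.restrict (Ioc (0 : ℝ) (2 * π)))
      ((2 : ℝ) ^ s * r ^ s + 2 ^ s)).mul_prod hw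
    refine hw2.mono' (Measurable.aestronglyMeasurable ?_) (Eventually.of_forall fun q => ?_)
    · have := hgc.measurable
      unfold Function.uncurry
      fun_prop
    · simp only [Function.uncurry]
      rw [Real.norm_of_nonneg (mul_nonneg (besselKernel_nonneg _) (by positivity))]
      have hwt := norm_rpow_le_weight (R := max 1 (2 * s)) (le_max_left _ _) hs.le le_rfl (0 - q.2)
      have hwt1 := one_le_weight (R := max 1 (2 * s)) (le_max_left _ _) hs.le (0 - q.2)
      have hzn : ‖(0 : E n) - q.2‖ = ‖q.2‖ := by simp
      rw [hzn] at hwt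
      have hb : ‖x - S q.1 q.2‖ ^ s ≤ ((2 : ℝ) ^ s * r ^ s + 2 ^ s) * weight (max 1 (2 * s)) s (0 - q.2) := by
        have hle : ‖x - S q.1 q.2‖ ≤ 2 * max r ‖q.2‖ := by
          have := norm_sub_le x (S q.1 q.2)
          rw [(S q.1).norm_map] at this
          linarith [le_max_left r ‖q.2‖, le_max_right r ‖q.2‖]
        have h2s : 0 < (2 : ℝ) ^ s := by positivity
        have hrs : 0 < r ^ s := by positivity
        calc _ ≤ (2 * max r ‖q.2‖) ^ s := by gcongr
          _ = 2 ^ s * (max r ‖q.2‖) ^ s := Real.mul_rpow (by norm_num) (by positivity)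
          _ ≤ 2 ^ s * (r ^ s + ‖q.2‖ ^ s) := by
              gcongr
              rcases le_total r ‖q.2‖ with h | h
              · rw [max_eq_right h]; linarith
              · rw [max_eq_left h]; linarith [Real.rpow_nonneg (norm_nonneg q.2) s]
          _ ≤ 2 ^ s * (r ^ s * weight (max 1 (2 * s)) s (0 - q.2)
              + weight (max 1 (2 * s)) s (0 - q.2)) := by
              gcongr
              exact le_mul_of_one_le_right hrs.le hwt1
          _ = _ := by ring
      have := mul_le_mul_of_nonneg_left hb (besselKernel_nonneg q.2)
      linarith
  have hswap := integral_integral_swap hint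
  simp only [← hrot] at hswap
  rw [setIntegral_const] at hswap
  have hlow : 2 * π * r ^ s ≤ ∫ z : E n, ∫ θ in Ioc (0 : ℝ) (2 * π),
      besselKernel n z * ‖x - S θ z‖ ^ s := by
    calc 2 * π * r ^ s = ∫ z : E n, besselKernel n z * (2 * π * r ^ s) := by
          rw [integral_mul_const, integral_besselKernel hn1, one_mul]
      _ ≤ _ := by
        refine integral_mono ((integrable_besselKernel hn1).mul_const _)
          hint.integral_prod_right fun z => ?_
        simp only
        rw [integral_const_mul]
        refine mul_le_mul_of_nonneg_left ?_ (besselKernel_nonneg z)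
        refine (rpow_le_integral_norm_sub_circle hs hr0
          (⟨inner ℝ e₁ z, - inner ℝ e₂ z⟩ : ℂ)).trans ?_
        rw [← intervalIntegral.integral_of_le (by positivity)]
        refine intervalIntegral.integral_mono_on (by positivity) ?_ ?_ fun θ _ => ?_
        · exact (Continuous.rpow_const (by fun_prop) fun _ => Or.inr hs.le).intervalIntegrable _ _
        · exact (hgc.comp (by fun_prop : Continuous fun θ : ℝ => (θ, z))).intervalIntegrable _ _
        · gcongr
          exact hplane θ z
  rw [← hswap] at hlow
  simp [Measure.real, Real.pi_pos.le] at hlow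
  nlinarith [Real.pi_pos]

/-- `|x|^s` lies below its Bessel potential, for every `s ∈ J_n⁺`. -/
theorem norm_rpow_le_besselOp (hn : 1 ≤ n) {s : ℝ} (hs : s ∈ JPlus n) (x : E n) :
    ‖x‖ ^ s ≤ besselOp (fun y : E n => ‖y‖ ^ s) x := by
  obtain ⟨h1, h0⟩ := hs
  rcases h0.eq_or_lt with rfl | hpos
  · rw [besselOp_eq]
    simp [integral_besselKernel hn]
  · rcases hn.eq_or_lt with rfl | hn2
    · refine norm_rpow_le_besselOp_of_one_le le_rfl ?_ x
      push_cast at h1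
      by_contra hlt
      nlinarith
    · exact norm_rpow_le_besselOp_of_two_le hn2 hpos x

/-! ### Admissible constants -/

theorem IsComparable.measurable_section {T : EReal} {σ lo hi : ℝ} {Λ : ℝ → ℝ} {V : ℝ → E n → ℝ}
    (h : IsComparable T σ Λ lo hi V) (t : ℝ) : Measurable (V t) :=
  h.measurable.comp measurable_prodMk_left

theorem besselLowerBound_shellMass (hn : 1 ≤ n) {T : EReal} {σ lo hi D : ℝ} {Λ : ℝ → ℝ}
    {V : ℝ → E n → ℝ} (hσ : 0 ≤ σ) (h : IsComparable T σ Λ lo hi V) :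
    BesselLowerBound T σ Λ lo V D (shellMass n) := by
  intro d hd _ t ht x
  have hΛ := h.pos t
  have hlo := h.lo_pos
  have hhi := h.hi_pos
  have hsd : 0 ≤ σ + d := by positivity
  rw [mul_assoc]
  refine shellMass_mul_le_besselOp hn
    (fun y => mul_nonneg (h.nonneg t ht y) (by positivity)) ?_ (by positivity) ?_
  · refine integrable_besselKernel_mul hn (R := max 1 (2 * (σ + d))) (a := σ + d) (C := hi * Λ t)
      (le_max_left _ _) hsd (le_max_right _ _)
      ((h.measurable_section t).mul (measurable_norm_rpow d)) (fun y => ?_) x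
    change |V t y * ‖y‖ ^ d| ≤ _
    rw [abs_of_nonneg (mul_nonneg (h.nonneg t ht y) (by positivity))]
    calc V t y * ‖y‖ ^ d ≤ hi * Λ t * ‖y‖ ^ σ * ‖y‖ ^ d := by gcongr; exact h.upper t ht y
      _ = hi * Λ t * ‖y‖ ^ (σ + d) := by rw [Real.rpow_add_of_nonneg (norm_nonneg y) hσ hd]; ring
      _ ≤ _ := by
        gcongr
        exact norm_rpow_le_weight (le_max_left _ _) hsd le_rfl y
  · intro z hz1 _ hxz
    have hsq := norm_le_norm_sub_of_inner_nonpos hxz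
    have h1 : 1 ≤ ‖x - z‖ := by nlinarith [norm_nonneg (x - z), sq_nonneg ‖x‖]
    have h2 : ‖x‖ ≤ ‖x - z‖ := by
      refine le_of_sq_le_sq ?_ (norm_nonneg _)
      nlinarith [sq_nonneg ‖z‖]
    calc lo * Λ t * ‖x‖ ^ (σ + d) ≤ lo * Λ t * ‖x - z‖ ^ (σ + d) := by gcongr
      _ = lo * Λ t * ‖x - z‖ ^ σ * ‖x - z‖ ^ d := by
        rw [Real.rpow_add_of_nonneg (norm_nonneg _) hσ hd]; ring
      _ ≤ _ := by gcongr; exact h.lower t ht _ h1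

/-! ### Growth and integrability of the source term -/

/-- The standing assumptions of the comparison argument on the time interval `[0, S]`. -/
structure Regime (n : ℕ) (p σ a R S : ℝ) (T : EReal) (Λ : ℝ → ℝ) (lo hi : ℝ)
    (V : ℝ → E n → ℝ) : Prop where
  dim_pos : 1 ≤ n
  p_pos : 0 < p
  p_lt : p < 1
  σ_nonneg : 0 ≤ σ
  σ_le : σ ≤ (1 - p) * a
  one_le_R : 1 ≤ R
  a_le : 2 * a ≤ R
  S_pos : 0 < S
  mem_time : ∀ τ ∈ Ioc 0 S, τ ∈ timeIoo T
  comp : IsComparable T σ Λ lo hi V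

/-- A nonnegative function that is jointly continuous, and of growth at most `C (R² + |x|²)^(a/2)`
uniformly in time. -/
structure Profile (R a C : ℝ) (μ : ℝ → E n → ℝ) : Prop where
  continuous : Continuous (Function.uncurry μ)
  nonneg : ∀ t x, 0 ≤ μ t x
  le : ∀ t x, μ t x ≤ C * weight R a x

/-- The integrand `μ + e^((1-p)t) V μ^p` of the mild formulation. -/
def source (p : ℝ) (V : ℝ → E n → ℝ) (μ : ℝ → E n → ℝ) (t : ℝ) (x : E n) : ℝ :=
  μ t x + exp ((1 - p) * t) * (V t x * μ t x ^ p)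

/-- The condition `a ≥ σ/(1-p)` says `σ + p a ≤ a`, so the nonlinearity does not leave the growth
class of the weight. -/
theorem norm_rpow_mul_weight_rpow_le {R a p σ : ℝ} (hR : 1 ≤ R) (hσ : 0 ≤ σ)
    (hσa : σ ≤ (1 - p) * a) (y : E n) :
    ‖y‖ ^ σ * weight R a y ^ p ≤ weight R a y := by
  have h0 : 1 ≤ R ^ 2 + ‖y‖ ^ 2 := by nlinarith [sq_nonneg ‖y‖]
  calc ‖y‖ ^ σ * weight R a y ^ p ≤ weight R σ y * weight R a y ^ p := by
        have := norm_rpow_le_weight hR hσ le_rfl y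
        have : 0 ≤ weight R a y := by unfold weight; positivity
        gcongr
    _ = (R ^ 2 + ‖y‖ ^ 2) ^ (σ / 2 + a / 2 * p) := by
        unfold weight
        rw [← Real.rpow_mul (by positivity), ← Real.rpow_add (by positivity)]
    _ ≤ _ := Real.rpow_le_rpow_of_exponent_le h0 (by linarith)

theorem Profile.bound_nonneg {R a C : ℝ} {μ : ℝ → E n → ℝ} (h : Profile R a C μ) (hR : 1 ≤ R)
    (ha : 0 ≤ a) : 0 ≤ C := by
  have := (h.nonneg 0 0).trans (h.le 0 0)
  exact nonneg_of_mul_nonneg_left this (weight_pos hR ha 0)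

namespace Regime

variable {p σ a R S lo hi : ℝ} {T : EReal} {Λ : ℝ → ℝ} {V : ℝ → E n → ℝ}

theorem a_nonneg (H : Regime n p σ a R S T Λ lo hi V) : 0 ≤ a := by
  have h1 := H.σ_nonneg.trans H.σ_le
  exact nonneg_of_mul_nonneg_right h1 (by linarith [H.p_lt])

theorem exists_bound (H : Regime n p σ a R S T Λ lo hi V) :
    ∃ L, 0 < L ∧ ∀ t ∈ Icc 0 S, exp ((1 - p) * t) * Λ t ≤ L := by
  have hc : Continuous fun t => exp ((1 - p) * t) * Λ t := by
    have := H.comp.continuous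
    fun_prop
  obtain ⟨L, hL⟩ := isCompact_Icc.bddAbove_image (hc.continuousOn (s := Icc 0 S))
  exact ⟨max L 1, by positivity, fun t ht => (hL ⟨t, ht, rfl⟩).trans (le_max_left _ _)⟩

theorem potential_mul_rpow_le (H : Regime n p σ a R S T Λ lo hi V) {C t : ℝ} (ht : t ∈ Ioc 0 S)
    (hC : 0 ≤ C) {r : ℝ} (y : E n) (hr0 : 0 ≤ r) (hr : r ≤ C * weight R a y) :
    V t y * r ^ p ≤ hi * Λ t * C ^ p * weight R a y := by
  have hw := weight_pos H.one_le_R H.a_nonneg y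
  have hp := H.p_pos
  have hΛ := H.comp.pos t
  have hhi := H.comp.hi_pos
  calc V t y * r ^ p ≤ hi * Λ t * ‖y‖ ^ σ * (C * weight R a y) ^ p := by
        gcongr; exact H.comp.upper t (H.mem_time t ht) y
    _ = hi * Λ t * C ^ p * (‖y‖ ^ σ * weight R a y ^ p) := by
        rw [Real.mul_rpow hC hw.le]; ring
    _ ≤ _ := by
        gcongr
        exact norm_rpow_mul_weight_rpow_le H.one_le_R H.σ_nonneg H.σ_le y

theorem measurable_source (H : Regime n p σ a R S T Λ lo hi V) {C : ℝ} {μ : ℝ → E n → ℝ}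
    (hμ : Profile R a C μ) : Measurable (Function.uncurry (source p V μ)) := by
  have h1 : Measurable fun z : ℝ × E n => μ z.1 z.2 := hμ.continuous.measurable
  have h2 := H.comp.measurable
  unfold source Function.uncurry
  fun_prop

theorem source_nonneg (H : Regime n p σ a R S T Λ lo hi V) {C t : ℝ} {μ : ℝ → E n → ℝ}
    (hμ : Profile R a C μ) (ht : t ∈ Ioc 0 S) (y : E n) : 0 ≤ source p V μ t y :=
  add_nonneg (hμ.nonneg t y) (mul_nonneg (exp_pos _).le (mul_nonneg
    (H.comp.nonneg t (H.mem_time t ht) y) (Real.rpow_nonneg (hμ.nonneg t y) p)))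

theorem exists_source_le (H : Regime n p σ a R S T Λ lo hi V) {C : ℝ} {μ : ℝ → E n → ℝ}
    (hμ : Profile R a C μ) :
    ∃ C', ∀ t ∈ Ioc 0 S, ∀ y, |source p V μ t y| ≤ C' * weight R a y := by
  obtain ⟨L, hL, hb⟩ := H.exists_bound
  have hC := hμ.bound_nonneg H.one_le_R H.a_nonneg
  refine ⟨C + hi * L * C ^ p, fun t ht y => ?_⟩
  rw [abs_of_nonneg (H.source_nonneg hμ ht y), source, add_mul]
  have hw := weight_pos H.one_le_R H.a_nonneg y
  have hhi := H.comp.hi_pos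
  refine add_le_add (hμ.le t y) ?_
  calc _ ≤ exp ((1 - p) * t) * (hi * Λ t * C ^ p * weight R a y) := by
        exact mul_le_mul_of_nonneg_left
          (H.potential_mul_rpow_le ht hC y (hμ.nonneg t y) (hμ.le t y)) (exp_pos _).le
    _ = hi * (exp ((1 - p) * t) * Λ t) * C ^ p * weight R a y := by ring
    _ ≤ _ := by gcongr; exact hb t ⟨ht.1.le, ht.2⟩

theorem integrable_source (H : Regime n p σ a R S T Λ lo hi V) {C t : ℝ} {μ : ℝ → E n → ℝ}
    (hμ : Profile R a C μ) (ht : t ∈ Ioc 0 S) (x : E n) :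
    Integrable (fun y : E n => besselKernel n (x - y) * source p V μ t y) := by
  obtain ⟨C', hC'⟩ := H.exists_source_le hμ
  exact integrable_besselKernel_mul H.dim_pos H.one_le_R H.a_nonneg H.a_le
    ((H.measurable_source hμ).comp measurable_prodMk_left) (hC' t ht) x

theorem abs_besselOp_le (H : Regime n p σ a R S T Λ lo hi V) {C : ℝ} {φ : E n → ℝ}
    (hφ : Measurable φ) (hC : ∀ y, |φ y| ≤ C * weight R a y) (x : E n) :
    |besselOp φ x| ≤ C * (expMoment n (a / R) * weight R a x) := by
  have hC0 : 0 ≤ C := nonneg_of_mul_nonneg_left ((abs_nonneg _).trans (hC 0))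
    (weight_pos H.one_le_R H.a_nonneg 0)
  have hi : ∀ {ψ : E n → ℝ}, Measurable ψ → (∀ y, |ψ y| ≤ C * weight R a y) →
      Integrable (fun y : E n => besselKernel n (x - y) * ψ y) := fun h1 h2 =>
    integrable_besselKernel_mul H.dim_pos H.one_le_R H.a_nonneg H.a_le h1 h2 x
  have hw := (continuous_weight (n := n) (R := R) H.a_nonneg).measurable
  have hw0 := fun y : E n => (weight_pos H.one_le_R H.a_nonneg y).le
  calc |besselOp φ x| ≤ besselOp (fun y => |φ y|) x := by
        unfold besselOp
        refine (abs_integral_le_integral_abs).trans (le_of_eq ?_)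
        simp only [abs_mul, abs_of_nonneg (besselKernel_nonneg _)]
    _ ≤ besselOp (fun y => C * weight R a y) x := by
        refine besselOp_mono (hi (measurable_norm.comp hφ) (by simpa using hC))
          (hi (by fun_prop) (fun y => ?_)) (Eventually.of_forall hC)
        rw [abs_of_nonneg (mul_nonneg hC0 (hw0 y))]
    _ = C * besselOp (weight R a) x := besselOp_const_mul _ _ _
    _ ≤ _ := by
        gcongr
        exact besselOp_weight_le H.dim_pos H.one_le_R H.a_nonneg H.a_le x

theorem intervalIntegrable_besselOp (H : Regime n p σ a R S T Λ lo hi V) {C t : ℝ}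
    {f : ℝ → E n → ℝ} (hf : Measurable (Function.uncurry f)) (ht : t ∈ Icc 0 S)
    (hC : ∀ τ ∈ Ioc 0 S, ∀ y, |f τ y| ≤ C * weight R a y) (x : E n) :
    IntervalIntegrable (fun τ => besselOp (f τ) x) volume 0 t := by
  rw [intervalIntegrable_iff_integrableOn_Ioc_of_le ht.1]
  refine Measure.integrableOn_of_bounded (M := C * (expMoment n (a / R) * weight R a x))
    measure_Ioc_lt_top.ne ?_ ?_
  · refine StronglyMeasurable.aestronglyMeasurable ?_
    refine StronglyMeasurable.integral_prod_right
      (f := fun (τ : ℝ) (y : E n) => besselKernel n (x - y) * f τ y) ?_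
    apply Measurable.stronglyMeasurable
    have := measurable_besselKernel (n := n)
    have hf' : Measurable fun z : ℝ × E n => f z.1 z.2 := hf
    unfold Function.uncurry
    fun_prop
  · refine (ae_restrict_iff' measurableSet_Ioc).2 (Eventually.of_forall fun τ hτ => ?_)
    exact H.abs_besselOp_le (hf.comp measurable_prodMk_left) (hC τ ⟨hτ.1, hτ.2.trans ht.2⟩) x

theorem intervalIntegrable_besselOp_source (H : Regime n p σ a R S T Λ lo hi V) {C t : ℝ}
    {μ : ℝ → E n → ℝ} (hμ : Profile R a C μ) (ht : t ∈ Icc 0 S) (x : E n) :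
    IntervalIntegrable (fun τ => besselOp (source p V μ τ) x) volume 0 t := by
  obtain ⟨C', hC'⟩ := H.exists_source_le hμ
  exact H.intervalIntegrable_besselOp (H.measurable_source hμ) ht hC' x

/-- The two time integrals merge because the profile's growth bound makes all the integrals involved
converge. The rest of the argument uses only this single-source form. -/
theorem sMildOp_eq (H : Regime n p σ a R S T Λ lo hi V) {C t : ℝ}
    {μ : ℝ → E n → ℝ} (hμ : Profile R a C μ) (ht : t ∈ Icc 0 S) (u₀ : E n → ℝ) (x : E n) :
    sMildOp p V u₀ μ t x = u₀ x + ∫ τ in (0 : ℝ)..t, besselOp (source p V μ τ) x := by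
  have hm : Measurable (Function.uncurry μ) := hμ.continuous.measurable
  have hb : ∀ τ ∈ Ioc 0 S, ∀ y, |μ τ y| ≤ C * weight R a y := fun τ _ y => by
    rw [abs_of_nonneg (hμ.nonneg τ y)]; exact hμ.le τ y
  have hadd : ∀ τ ∈ Ioc 0 S, besselOp (source p V μ τ) x = besselOp (μ τ) x +
      exp ((1 - p) * τ) * besselOp (fun y => V τ y * μ τ y ^ p) x := fun τ hτ => by
    have h1 : Integrable (fun y : E n => besselKernel n (x - y) * μ τ y) :=
      integrable_besselKernel_mul H.dim_pos H.one_le_R H.a_nonneg H.a_le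
        (hm.comp (measurable_prodMk_left (x := τ))) (hb τ hτ) x
    have h2 := (H.integrable_source hμ hτ x).sub h1
    rw [← besselOp_const_mul]
    unfold besselOp
    rw [← integral_add h1 (h2.congr (Eventually.of_forall fun y => ?_))]
    · refine integral_congr_ae (Eventually.of_forall fun y => ?_)
      simp only [source]; ring
    · simp only [source, Pi.sub_apply]; ring
  have hi1 := H.intervalIntegrable_besselOp hm ht hb x
  have hi2 := (H.intervalIntegrable_besselOp_source hμ ht x).sub hi1
  have hΙ : ∀ τ ∈ uIoc (0 : ℝ) t, τ ∈ Ioc 0 S := fun τ hτ => by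
    rw [uIoc_of_le ht.1] at hτ
    exact ⟨hτ.1, hτ.2.trans ht.2⟩
  unfold sMildOp
  rw [add_assoc, ← intervalIntegral.integral_add hi1 (hi2.congr fun τ hτ => ?_)]
  · congr 1
    refine intervalIntegral.integral_congr_ae (Eventually.of_forall fun τ hτ => ?_)
    exact (hadd τ (hΙ τ hτ)).symm
  · simp only [hadd τ (hΙ τ hτ)]; ring

end Regime

/-! ### Time-clamped representatives of functions in `C([0,T); BC_a)` -/

theorem MemBC.exists_le {a : ℝ} (ha : 0 ≤ a) {φ : E n → ℝ} (h : MemBC a φ) :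
    ∃ C, ∀ x, |φ x| ≤ C * weight 1 a x := by
  obtain ⟨hc, C, R₀, hb⟩ := h
  obtain ⟨D, hD⟩ := (isCompact_closedBall (0 : E n) R₀).bddAbove_image
    (hc.abs.continuousOn)
  refine ⟨max (max C D) 0, fun x => ?_⟩
  have hw := one_le_weight (R := 1) le_rfl ha x
  rcases le_total R₀ ‖x‖ with hx | hx
  · calc |φ x| ≤ C * ‖x‖ ^ a := hb x hx
      _ ≤ max (max C D) 0 * ‖x‖ ^ a := by
          gcongr; exact (le_max_left _ _).trans (le_max_left _ _)
      _ ≤ _ := by gcongr; exact norm_rpow_le_weight le_rfl ha le_rfl x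
  · calc |φ x| ≤ D := hD ⟨x, by simpa using hx, rfl⟩
      _ ≤ max (max C D) 0 := (le_max_right _ _).trans (le_max_left _ _)
      _ ≤ _ := le_mul_of_one_le_right (le_max_right _ _) hw

/-- The bound `h` makes the supremum genuine: an unbounded real supremum has the default value `0`.
-/
theorem abs_le_weightedNorm_mul {a C : ℝ} {φ : E n → ℝ} (h : ∀ x, |φ x| ≤ C * weight 1 a x)
    (x : E n) : |φ x| ≤ weightedNorm 1 a φ * weight 1 a x := by
  have e : ∀ y : E n, ((1 : ℝ) ^ 2 + ‖y‖ ^ 2) ^ (-a / 2) * weight 1 a y = 1 := fun y => by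
    unfold weight
    rw [← Real.rpow_add (by positivity)]
    convert Real.rpow_zero _ using 2
    ring
  have hbdd : BddAbove (range fun y : E n => ((1 : ℝ) ^ 2 + ‖y‖ ^ 2) ^ (-a / 2) * |φ y|) := by
    refine ⟨C, ?_⟩
    rintro _ ⟨y, rfl⟩
    calc _ ≤ ((1 : ℝ) ^ 2 + ‖y‖ ^ 2) ^ (-a / 2) * (C * weight 1 a y) := by
          exact mul_le_mul_of_nonneg_left (h y) (by positivity)
      _ = C * (((1 : ℝ) ^ 2 + ‖y‖ ^ 2) ^ (-a / 2) * weight 1 a y) := by ring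
      _ = C := by rw [e, mul_one]
  have h1 := le_ciSup hbdd x
  have hw : 0 ≤ weight 1 a x := by unfold weight; positivity
  calc |φ x| = (((1 : ℝ) ^ 2 + ‖x‖ ^ 2) ^ (-a / 2) * |φ x|) * weight 1 a x := by
        rw [mul_right_comm, e, one_mul]
    _ ≤ _ := mul_le_mul_of_nonneg_right h1 hw

/-- The projection of the time axis on `[0, S]`. -/
def clamp (S t : ℝ) : ℝ := max 0 (min t S)

theorem clamp_of_mem {S t : ℝ} (ht : t ∈ Icc 0 S) : clamp S t = t := by
  unfold clamp; rw [min_eq_left ht.2, max_eq_right ht.1]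

theorem clamp_mem {S : ℝ} (hS : 0 ≤ S) (t : ℝ) : clamp S t ∈ Icc 0 S :=
  ⟨le_max_left _ _, max_le hS (min_le_right _ _)⟩

theorem continuous_clamp (S : ℝ) : Continuous (clamp S) := by unfold clamp; fun_prop

theorem timeIco_of_le {T : EReal} {S t : ℝ} (hS : S ∈ timeIco T) (ht : t ∈ Icc 0 S) :
    t ∈ timeIco T :=
  ⟨ht.1, (EReal.coe_le_coe_iff.2 ht.2).trans_lt hS.2⟩

/-- Membership in `𝓩` says nothing outside `[0, T)`, so time is clamped to `[0, S]`. Norm continuity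
gives joint continuity and a growth bound near each time; compactness of `[0, S]` makes the latter
uniform. -/
theorem exists_profile {T : EReal} {a R S : ℝ} (ha : 0 ≤ a) (hR : 1 ≤ R) {u : ℝ → E n → ℝ}
    (hu : MemZ T a u) (h0 : ∀ t ∈ timeIco T, ∀ x, 0 ≤ u t x) (hS : S ∈ timeIco T) :
    ∃ C, Profile R a C (fun t x => exp (clamp S t) * u (clamp S t) x) := by
  have hcl : ∀ t, clamp S t ∈ timeIco T := fun t => timeIco_of_le hS (clamp_mem hS.1 t)
  have hdiff : ∀ t ∈ timeIco T, ∀ t₀ ∈ timeIco T, ∀ x,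
      |u t x - u t₀ x| ≤ weightedNorm 1 a (fun x => u t x - u t₀ x) * weight 1 a x := by
    intro t ht t₀ ht₀ x
    obtain ⟨C, hC⟩ := (hu.1 t ht).exists_le ha
    obtain ⟨C₀, hC₀⟩ := (hu.1 t₀ ht₀).exists_le ha
    refine abs_le_weightedNorm_mul (φ := fun x => u t x - u t₀ x) (C := C + C₀) (fun y => ?_) x
    rw [add_mul]
    exact (abs_sub _ _).trans (add_le_add (hC y) (hC₀ y))
  have htend : ∀ t₀, Tendsto (fun t => weightedNorm 1 a (fun x => u (clamp S t) x -
      u (clamp S t₀) x)) (𝓝 t₀) (𝓝 0) := fun t₀ =>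
    (hu.2 _ (hcl t₀)).comp (tendsto_nhdsWithin_iff.2
      ⟨(continuous_clamp S).tendsto t₀, Eventually.of_forall hcl⟩)
  have hcont : Continuous (Function.uncurry fun t x => u (clamp S t) x) := by
    rw [continuous_iff_continuousAt]
    rintro ⟨t₀, x₀⟩
    have hx : Tendsto (fun z : ℝ × E n => u (clamp S t₀) z.2) (𝓝 (t₀, x₀))
        (𝓝 (u (clamp S t₀) x₀)) :=
      ((hu.1 _ (hcl t₀)).1.comp continuous_snd).tendsto _
    have hd : Tendsto (fun z : ℝ × E n => u (clamp S z.1) z.2 - u (clamp S t₀) z.2)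
        (𝓝 (t₀, x₀)) (𝓝 0) := by
      have hw : Tendsto (fun z : ℝ × E n => weightedNorm 1 a (fun x => u (clamp S z.1) x -
          u (clamp S t₀) x) * weight 1 a z.2) (𝓝 (t₀, x₀)) (𝓝 (0 * weight 1 a x₀)) :=
        ((htend t₀).comp (continuous_fst.tendsto _)).mul
          (((continuous_weight ha).comp continuous_snd).tendsto _)
      rw [zero_mul] at hw
      exact squeeze_zero_norm (fun z => hdiff _ (hcl z.1) _ (hcl t₀) z.2) hw
    have := hd.add hx
    rw [zero_add] at this
    exact this.congr fun z => by simp [Function.uncurry]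
  obtain ⟨C, hC⟩ : ∃ C, ∀ t ∈ Icc 0 S, ∀ x, |u t x| ≤ C * weight 1 a x := by
    have hcov : ∀ t₀ ∈ Icc 0 S, ∃ U ∈ 𝓝[Icc 0 S] t₀, ∃ C, ∀ t ∈ U, t ∈ Icc 0 S → ∀ x, |u t x| ≤ C * weight 1 a x := by
      intro t₀ ht₀
      obtain ⟨C₀, hC₀⟩ := (hu.1 t₀ (timeIco_of_le hS ht₀)).exists_le ha
      refine ⟨_, mem_nhdsWithin_of_mem_nhds ((htend t₀).eventually_le_const one_pos), 1 + C₀,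
        fun t ht hts x => ?_⟩
      have ht' : weightedNorm 1 a (fun x => u (clamp S t) x - u (clamp S t₀) x) ≤ 1 := ht
      rw [clamp_of_mem hts, clamp_of_mem ht₀] at ht'
      have h1 := hdiff t (timeIco_of_le hS hts) t₀ (timeIco_of_le hS ht₀) x
      have hw := weight_pos (R := 1) le_rfl ha x
      have h2 := mul_le_mul_of_nonneg_right ht' hw.le
      have h3 := abs_sub_abs_le_abs_sub (u t x) (u t₀ x)
      have h4 := hC₀ x
      linarith
    refine isCompact_Icc.induction_on (p := fun s => ∃ C, ∀ t ∈ s, t ∈ Icc 0 S → ∀ x,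
      |u t x| ≤ C * weight 1 a x) ⟨0, by simp⟩ ?_ ?_ hcov |>.imp fun C hC t ht => hC t ht ht
    · rintro s s' hss ⟨C, hC⟩
      exact ⟨C, fun t ht => hC t (hss ht)⟩
    · rintro s s' ⟨C, hC⟩ ⟨C', hC'⟩
      refine ⟨max C C', fun t ht hts x => ?_⟩
      have hw := weight_pos (R := 1) le_rfl ha x
      rcases ht with ht | ht
      · exact (hC t ht hts x).trans (by gcongr; exact le_max_left _ _)
      · exact (hC' t ht hts x).trans (by gcongr; exact le_max_right _ _)
  have hC0 : 0 ≤ C := nonneg_of_mul_nonneg_left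
    ((abs_nonneg _).trans (hC 0 ⟨le_rfl, hS.1⟩ 0)) (weight_pos le_rfl ha 0)
  refine ⟨exp S * C, ?_, fun t x => mul_nonneg (exp_pos _).le (h0 _ (hcl t) x), fun t x => ?_⟩
  · exact (continuous_exp.comp ((continuous_clamp S).comp continuous_fst)).mul hcont
  · have hm := clamp_mem hS.1 t
    have hw := weight_pos (R := 1) le_rfl ha x
    rw [mul_assoc]
    calc _ ≤ exp S * (C * weight 1 a x) := by
          gcongr
          · exact h0 _ (hcl t) x
          · exact hm.2
          · exact (le_abs_self _).trans (hC _ hm x)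
      _ ≤ _ := by gcongr; exact weight_mono_radius zero_le_one hR ha x

/-! ### The intrinsic time `∫₀ᵗ e^((1-p)s) Λ(s) ds` -/

/-- The primitive `∫₀ᵗ e^((1-p)s) Λ(s) ds`. -/
def intrinsicTime (p : ℝ) (Λ : ℝ → ℝ) (t : ℝ) : ℝ := ∫ s in (0 : ℝ)..t, exp ((1 - p) * s) * Λ s

section IntrinsicTime

variable {p : ℝ} {Λ : ℝ → ℝ}

theorem hasDerivAt_intrinsicTime (hΛ : Continuous Λ) (t : ℝ) :
    HasDerivAt (intrinsicTime p Λ) (exp ((1 - p) * t) * Λ t) t :=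
  ((by fun_prop : Continuous fun s => exp ((1 - p) * s) * Λ s)).integral_hasStrictDerivAt 0 t
    |>.hasDerivAt

theorem continuous_intrinsicTime (hΛ : Continuous Λ) : Continuous (intrinsicTime p Λ) :=
  continuous_iff_continuousAt.2 fun t => (hasDerivAt_intrinsicTime hΛ t).continuousAt

@[simp] theorem intrinsicTime_zero : intrinsicTime p Λ 0 = 0 := by simp [intrinsicTime]

theorem strictMono_intrinsicTime (hΛ : Continuous Λ) (hpos : ∀ t, 0 < Λ t) :
    StrictMono (intrinsicTime p Λ) :=
  strictMono_of_hasDerivAt_pos (hasDerivAt_intrinsicTime hΛ)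
    fun t => mul_pos (exp_pos _) (hpos t)

theorem intrinsicTime_pos (hΛ : Continuous Λ) (hpos : ∀ t, 0 < Λ t) {t : ℝ} (ht : 0 < t) :
    0 < intrinsicTime p Λ t := by
  simpa using strictMono_intrinsicTime (p := p) hΛ hpos ht

theorem continuous_intrinsicTime_rpow_mul (hΛ : Continuous Λ) {m : ℝ} (hm : 1 ≤ m) :
    Continuous fun s => intrinsicTime p Λ s ^ (m - 1) * (exp ((1 - p) * s) * Λ s) := by
  have h1 : Continuous fun s => intrinsicTime p Λ s ^ (m - 1) :=
    (continuous_intrinsicTime hΛ).rpow_const fun _ => Or.inr (by linarith)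
  fun_prop

theorem integral_intrinsicTime_rpow_mul (hΛ : Continuous Λ) {m : ℝ} (hm : 1 ≤ m) (t : ℝ) :
    ∫ s in (0 : ℝ)..t, intrinsicTime p Λ s ^ (m - 1) * (exp ((1 - p) * s) * Λ s) =
      intrinsicTime p Λ t ^ m / m := by
  have hm0 : m ≠ 0 := by linarith
  rw [intervalIntegral.integral_eq_sub_of_hasDerivAt (f := fun s => intrinsicTime p Λ s ^ m / m)
    (fun s _ => ?_) ((continuous_intrinsicTime_rpow_mul hΛ hm).intervalIntegrable _ _)]
  · simp [Real.zero_rpow hm0]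
  · have := ((hasDerivAt_intrinsicTime (p := p) hΛ s).rpow_const (p := m) (Or.inr hm)).div_const m
    refine this.congr_deriv ?_
    rw [mul_right_comm, mul_div_cancel_right₀ _ hm0]
    ring

end IntrinsicTime

theorem integral_exp_mul_le {l t : ℝ} (hl : 0 < l) :
    ∫ s in (0 : ℝ)..t, exp (l * s) ≤ exp (l * t) / l := by
  rw [intervalIntegral.integral_eq_sub_of_hasDerivAt (f := fun s => exp (l * s) / l)
    (fun s _ => ?_) (Continuous.intervalIntegrable (by fun_prop) _ _)]
  · simp; positivity
  · have := ((hasDerivAt_id s).const_mul l).exp.div_const l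
    refine this.congr_deriv ?_
    rw [mul_one, mul_div_cancel_right₀ _ hl.ne']
    rfl

theorem besselOp_mono_of_nonneg {φ ψ : E n → ℝ} {x : E n} (h0 : ∀ y, 0 ≤ φ y)
    (hψ : Integrable (fun y : E n => besselKernel n (x - y) * ψ y)) (h : ∀ y, φ y ≤ ψ y) :
    besselOp φ x ≤ besselOp ψ x :=
  integral_mono_of_nonneg
    (Eventually.of_forall fun y => mul_nonneg (besselKernel_nonneg _) (h0 y)) hψ
    (Eventually.of_forall fun y => mul_le_mul_of_nonneg_left (h y) (besselKernel_nonneg _))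

/-- By continuity `φ` stays above half of a positive value on some ball, and the kernel seen from
that ball decays at most exponentially. -/
theorem exists_exp_le_besselOp (hn : 1 ≤ n) {R a C : ℝ} (hR : 1 ≤ R) (ha : 0 ≤ a)
    (haR : 2 * a ≤ R) {φ : E n → ℝ} (hφ : Continuous φ) (h0 : ∀ x, 0 ≤ φ x) (hne : φ ≠ 0)
    (hC : ∀ x, φ x ≤ C * weight R a x) :
    ∃ c M : ℝ, 0 < c ∧ 0 < M ∧ ∀ x, c * exp (-(M * ‖x‖)) ≤ besselOp φ x := by
  obtain ⟨x₀, hx₀⟩ := Function.ne_iff.1 hne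
  have hpos : 0 < φ x₀ := lt_of_le_of_ne (h0 x₀) (Ne.symm hx₀)
  obtain ⟨r, hr, hball⟩ := Metric.isOpen_iff.1 (isOpen_lt continuous_const hφ) x₀
    (show φ x₀ / 2 < φ x₀ by linarith)
  obtain ⟨c, M, hc, hM, hK⟩ := exists_exp_le_besselKernel hn
  have hvol : 0 < (volume (Metric.ball x₀ r)).toReal :=
    ENNReal.toReal_pos (Metric.measure_ball_pos volume x₀ hr).ne' measure_ball_lt_top.ne
  refine ⟨c * exp (-(M * (‖x₀‖ + r))) * (φ x₀ / 2) * (volume (Metric.ball x₀ r)).toReal, M,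
    by positivity, hM, fun x => ?_⟩
  have hint := integrable_besselKernel_mul hn hR ha haR hφ.measurable (C := C)
    (fun y => by rw [abs_of_nonneg (h0 y)]; exact hC y) x
  have hK' : ∀ᵐ y : E n, c * exp (-(M * ‖x - y‖)) ≤ besselKernel n (x - y) :=
    (quasiMeasurePreserving_sub_left volume x).ae hK
  calc _ = ∫ y in Metric.ball x₀ r, c * exp (-(M * (‖x‖ + (‖x₀‖ + r)))) * (φ x₀ / 2) := by
        rw [setIntegral_const, mul_add M ‖x‖, neg_add, exp_add, smul_eq_mul, Measure.real]
        ring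
    _ ≤ ∫ y in Metric.ball x₀ r, besselKernel n (x - y) * φ y := by
        refine setIntegral_mono_on_ae (integrableOn_const measure_ball_lt_top.ne)
          hint.integrableOn measurableSet_ball ?_
        filter_upwards [hK'] with y hy hyb
        have h1 : φ x₀ / 2 ≤ φ y := le_of_lt (hball hyb)
        have h2 : ‖x - y‖ ≤ ‖x‖ + (‖x₀‖ + r) := by
          have hd : ‖y - x₀‖ < r := by simpa [dist_eq_norm] using hyb
          have h3 := norm_sub_le x y
          have h4 := norm_add_le (y - x₀) x₀
          rw [sub_add_cancel] at h4
          linarith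
        have h5 : c * exp (-(M * (‖x‖ + (‖x₀‖ + r)))) ≤ besselKernel n (x - y) := by
          refine le_trans ?_ hy
          gcongr
        exact mul_le_mul h5 h1 (by positivity) (besselKernel_nonneg _)
    _ ≤ _ := setIntegral_le_integral hint
        (Eventually.of_forall fun y => mul_nonneg (besselKernel_nonneg _) (h0 y))

namespace Regime

variable {p σ a R S lo hi : ℝ} {T : EReal} {Λ : ℝ → ℝ} {V : ℝ → E n → ℝ} {C C' m : ℝ}
  {μ ω : ℝ → E n → ℝ} {u₀ v₀ : E n → ℝ}

/-! ### Lower bounds for supersolutions -/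

theorem one_le_exponent (H : Regime n p σ a R S T Λ lo hi V) (hm : m = 1 / (1 - p)) : 1 ≤ m := by
  rw [hm, le_div_iff₀ (by linarith [H.p_lt])]; linarith [H.p_pos]

theorem exponent_mul (H : Regime n p σ a R S T Λ lo hi V) (hm : m = 1 / (1 - p)) :
    m * p = m - 1 := by
  have : (1 - p) ≠ 0 := by linarith [H.p_lt]
  rw [hm]; field_simp; ring

theorem integral_le_of_le_besselOp_source (H : Regime n p σ a R S T Λ lo hi V)
    (hμ : Profile R a C μ)
    (hsup : ∀ t ∈ Icc 0 S, ∀ x, u₀ x + ∫ τ in (0 : ℝ)..t, besselOp (source p V μ τ) x ≤ μ t x)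
    {t : ℝ} (ht : t ∈ Icc 0 S) {x : E n} (hu₀ : 0 ≤ u₀ x) {q : ℝ → ℝ}
    (hq : IntervalIntegrable q volume 0 t)
    (hle : ∀ τ ∈ Ioc 0 t, q τ ≤ besselOp (source p V μ τ) x) :
    ∫ τ in (0 : ℝ)..t, q τ ≤ μ t x := by
  have h1 := intervalIntegral.integral_mono_on_of_le_Ioo ht.1 hq
    (H.intervalIntegrable_besselOp_source hμ ht x) fun τ hτ => hle τ ⟨hτ.1, hτ.2.le⟩
  linarith [hsup t ht x]

/-- One step of the iteration improving lower bounds. -/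
theorem lower_bound_step (H : Regime n p σ a R S T Λ lo hi V) (hm : m = 1 / (1 - p))
    (hμ : Profile R a C μ)
    (hsup : ∀ t ∈ Icc 0 S, ∀ x, u₀ x + ∫ τ in (0 : ℝ)..t, besselOp (source p V μ τ) x ≤ μ t x)
    (hu₀ : ∀ x, 0 ≤ u₀ x) {A ε : ℝ} (hA : 0 ≤ A) {g g' : E n → ℝ} (hg : ∀ y, 0 ≤ g y)
    (h1 : ∀ τ ∈ Ioc 0 S, ∀ y, A * intrinsicTime p Λ τ ^ m * g y ≤ μ τ y)
    (h2 : ∀ τ ∈ Ioc 0 S, ∀ x, ε * Λ τ * g' x ≤ besselOp (fun y => V τ y * g y ^ p) x)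
    {t : ℝ} (ht : t ∈ Ioc 0 S) (x : E n) :
    A ^ p * ε / m * intrinsicTime p Λ t ^ m * g' x ≤ μ t x := by
  have hΛ := H.comp.continuous
  have hm1 := H.one_le_exponent hm
  have hint := integral_intrinsicTime_rpow_mul (p := p) hΛ hm1 t
  have hkey := H.integral_le_of_le_besselOp_source hμ hsup ⟨ht.1.le, ht.2⟩ (hu₀ x)
    (q := fun τ => A ^ p * ε * g' x *
      (intrinsicTime p Λ τ ^ (m - 1) * (exp ((1 - p) * τ) * Λ τ)))
    (((continuous_intrinsicTime_rpow_mul hΛ hm1).const_mul _).intervalIntegrable _ _) ?_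
  · rw [intervalIntegral.integral_const_mul, hint] at hkey
    refine le_trans (le_of_eq ?_) hkey
    ring
  · intro τ hτ
    have hτS : τ ∈ Ioc 0 S := ⟨hτ.1, hτ.2.trans ht.2⟩
    have hG := intrinsicTime_pos (p := p) hΛ H.comp.pos hτ.1
    have hV := H.comp.nonneg τ (H.mem_time τ hτS)
    set G := intrinsicTime p Λ τ with hGdef
    calc A ^ p * ε * g' x * (G ^ (m - 1) * (exp ((1 - p) * τ) * Λ τ))
        = (exp ((1 - p) * τ) * (A ^ p * G ^ (m - 1))) * (ε * Λ τ * g' x) := by ring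
      _ ≤ (exp ((1 - p) * τ) * (A ^ p * G ^ (m - 1))) *
          besselOp (fun y => V τ y * g y ^ p) x := by
          gcongr; exact h2 τ hτS x
      _ = besselOp (fun y => exp ((1 - p) * τ) * (A ^ p * G ^ (m - 1)) * (V τ y * g y ^ p)) x :=
          (besselOp_const_mul _ _ _).symm
      _ ≤ besselOp (source p V μ τ) x := by
          refine besselOp_mono_of_nonneg (fun y => ?_) (H.integrable_source hμ hτS x) fun y => ?_
          · have := hV y
            have := hg y
            positivity
          -- This is where `m p = m - 1` enters: the `p`-th power of `G^m` is, up to a constant, the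
          -- time derivative of `G^m` divided by `G'`.
          · have e : A ^ p * G ^ (m - 1) * g y ^ p = (A * G ^ m * g y) ^ p := by
              rw [Real.mul_rpow (by positivity) (hg y), Real.mul_rpow hA (by positivity),
                ← Real.rpow_mul hG.le, H.exponent_mul hm]
            have hp := H.p_pos
            have h3 : (A * G ^ m * g y) ^ p ≤ μ τ y ^ p :=
              Real.rpow_le_rpow (mul_nonneg (by positivity) (hg y)) (h1 τ hτS y) hp.le
            have h4 := mul_le_mul_of_nonneg_left h3 (mul_nonneg (exp_pos ((1 - p) * τ)).le (hV y))
            rw [← e] at h4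
            have := hμ.nonneg τ y
            unfold source
            linarith

/-- A shell vector changes the norm by at most `2`, which costs `e^(-2δ) ≥ e^(-2M)`. The constant is
thus the same for all rates `δ ≤ M`, as the iteration needs. -/
theorem besselOp_mul_exp_ge (H : Regime n p σ a R S T Λ lo hi V) {τ δ M : ℝ} (hδ : 0 ≤ δ)
    (hδM : δ ≤ M) (hτ : τ ∈ Ioc 0 S) (x : E n) :
    shellMass n * lo * exp (-(2 * M)) * Λ τ * exp (-(δ * ‖x‖)) ≤
      besselOp (fun y => V τ y * exp (-(δ * ‖y‖))) x := by
  have hT := H.mem_time τ hτ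
  have hlo := H.comp.lo_pos
  have hhi := H.comp.hi_pos
  have hΛ := H.comp.pos τ
  have hσ := H.σ_nonneg
  have hV := H.comp.nonneg τ hT
  have := shellMass_mul_le_besselOp H.dim_pos (f := fun y => V τ y * exp (-(δ * ‖y‖))) (x := x)
    (L := lo * Λ τ * (exp (-(2 * M)) * exp (-(δ * ‖x‖))))
    (fun y => mul_nonneg (hV y) (exp_pos _).le) ?_ (by positivity) ?_
  · refine le_trans (le_of_eq ?_) this
    ring
  · refine integrable_besselKernel_mul H.dim_pos (R := max 1 (2 * σ)) (a := σ) (C := hi * Λ τ)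
      (le_max_left _ _) hσ (le_max_right _ _)
      ((H.comp.measurable_section τ).mul (by fun_prop)) (fun y => ?_) x
    change |V τ y * exp (-(δ * ‖y‖))| ≤ _
    rw [abs_of_nonneg (mul_nonneg (hV y) (exp_pos _).le)]
    calc V τ y * exp (-(δ * ‖y‖)) ≤ V τ y * 1 := by
          have := hV y
          gcongr
          exact exp_le_one_iff.2 (by simp; positivity)
      _ ≤ hi * Λ τ * ‖y‖ ^ σ := by rw [mul_one]; exact H.comp.upper τ hT y
      _ ≤ _ := by gcongr; exact norm_rpow_le_weight (le_max_left _ _) hσ le_rfl y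
  · intro z hz1 hz2 hxz
    have hsq := norm_le_norm_sub_of_inner_nonpos hxz
    have h1 : 1 ≤ ‖x - z‖ := by nlinarith [norm_nonneg (x - z), sq_nonneg ‖x‖]
    have h2 : lo * Λ τ ≤ V τ (x - z) := by
      refine le_trans ?_ (H.comp.lower τ hT _ h1)
      exact le_mul_of_one_le_right (by positivity) (Real.one_le_rpow h1 hσ)
    have h3 : exp (-(2 * M)) * exp (-(δ * ‖x‖)) ≤ exp (-(δ * ‖x - z‖)) := by
      rw [← exp_add]
      refine exp_le_exp.2 ?_
      have := norm_sub_le x z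
      nlinarith
    exact mul_le_mul h2 h3 (by positivity) (hV _)

/-- As `μ ≥ u₀`, the linear term alone gives `μ ≥ t 𝓑u₀ ≥ c t e^(-M|x|)`. Since `m ≥ 1`, `G(t)^m ≤ L
t G(S)^(m-1)` converts the factor `t` into `G^m`. -/
theorem exists_initial_lower_bound (H : Regime n p σ a R S T Λ lo hi V) (hm : m = 1 / (1 - p))
    (hμ : Profile R a C μ)
    (hsup : ∀ t ∈ Icc 0 S, ∀ x, u₀ x + ∫ τ in (0 : ℝ)..t, besselOp (source p V μ τ) x ≤ μ t x)
    (hu₀ : ∀ x, 0 ≤ u₀ x) (hcont : Continuous u₀) (hne : u₀ ≠ 0) :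
    ∃ A M : ℝ, 0 < A ∧ 0 < M ∧ ∀ t ∈ Ioc 0 S, ∀ x,
      A * intrinsicTime p Λ t ^ m * exp (-(M * ‖x‖)) ≤ μ t x := by
  have hu₀μ : ∀ t ∈ Icc 0 S, ∀ x, u₀ x ≤ μ t x := fun t ht x => by
    have : 0 ≤ ∫ τ in (0 : ℝ)..t, besselOp (source p V μ τ) x := by
      rw [intervalIntegral.integral_of_le ht.1]
      exact setIntegral_nonneg measurableSet_Ioc fun τ hτ =>
        besselOp_nonneg (H.source_nonneg hμ ⟨hτ.1, hτ.2.trans ht.2⟩) x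
    linarith [hsup t ht x]
  obtain ⟨c, M, hc, hM, hexp⟩ := exists_exp_le_besselOp H.dim_pos H.one_le_R H.a_nonneg H.a_le
    hcont hu₀ hne (C := C) fun x => (hu₀μ 0 ⟨le_rfl, H.S_pos.le⟩ x).trans (hμ.le 0 x)
  obtain ⟨L, hL, hLb⟩ := H.exists_bound
  have hΛ := H.comp.continuous
  have hm1 := H.one_le_exponent hm
  have hmono := strictMono_intrinsicTime (p := p) hΛ H.comp.pos
  have hGS := intrinsicTime_pos (p := p) hΛ H.comp.pos H.S_pos
  set GS := intrinsicTime p Λ S with hGSdef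
  refine ⟨c / (L * GS ^ (m - 1)), M, by positivity, hM, fun t ht x => ?_⟩
  have htI : t ∈ Icc 0 S := ⟨ht.1.le, ht.2⟩
  have h1 : t * (c * exp (-(M * ‖x‖))) ≤ μ t x := by
    have := H.integral_le_of_le_besselOp_source hμ hsup htI (hu₀ x)
      (q := fun _ => c * exp (-(M * ‖x‖))) intervalIntegrable_const fun τ hτ => ?_
    · rwa [intervalIntegral.integral_const, smul_eq_mul, sub_zero] at this
    · have hτS : τ ∈ Ioc 0 S := ⟨hτ.1, hτ.2.trans ht.2⟩
      refine (hexp x).trans (besselOp_mono_of_nonneg hu₀ (H.integrable_source hμ hτS x) fun y => ?_)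
      refine (hu₀μ τ ⟨hτ.1.le, hτS.2⟩ y).trans ?_
      have := mul_nonneg (exp_pos ((1 - p) * τ)).le (mul_nonneg
        (H.comp.nonneg τ (H.mem_time τ hτS) y) (Real.rpow_nonneg (hμ.nonneg τ y) p))
      unfold source
      linarith
  have hG := intrinsicTime_pos (p := p) hΛ H.comp.pos ht.1
  have hGt : intrinsicTime p Λ t ≤ L * t := by
    have := intervalIntegral.integral_mono_on (μ := volume) ht.1.le
      (f := fun s => exp ((1 - p) * s) * Λ s) (g := fun _ => L)
      (Continuous.intervalIntegrable (by fun_prop) _ _) intervalIntegrable_const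
      fun s hs => hLb s ⟨hs.1, hs.2.trans ht.2⟩
    simpa [intrinsicTime, mul_comm] using this
  have hGm : intrinsicTime p Λ t ^ m ≤ L * t * GS ^ (m - 1) := by
    calc intrinsicTime p Λ t ^ m = intrinsicTime p Λ t * intrinsicTime p Λ t ^ (m - 1) := by
          rw [← Real.rpow_one_add' hG.le (by linarith)]; ring_nf
      _ ≤ _ := by
          have h6 : intrinsicTime p Λ t ≤ GS := hmono.monotone ht.2
          gcongr
          linarith
  calc _ ≤ c / (L * GS ^ (m - 1)) * (L * t * GS ^ (m - 1)) * exp (-(M * ‖x‖)) := by gcongr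
    _ = t * (c * exp (-(M * ‖x‖))) := by field_simp
    _ ≤ _ := h1

theorem tendsto_pow_zero (H : Regime n p σ a R S T Λ lo hi V) :
    Tendsto (fun k : ℕ => p ^ k) atTop (𝓝 0) :=
  tendsto_pow_atTop_nhds_zero_of_lt_one H.p_pos.le H.p_lt

/-- Supersolutions become spatially bounded away from zero immediately. -/
theorem exists_uniform_lower_bound (H : Regime n p σ a R S T Λ lo hi V) (hm : m = 1 / (1 - p))
    (hμ : Profile R a C μ)
    (hsup : ∀ t ∈ Icc 0 S, ∀ x, u₀ x + ∫ τ in (0 : ℝ)..t, besselOp (source p V μ τ) x ≤ μ t x)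
    (hu₀ : ∀ x, 0 ≤ u₀ x) (hcont : Continuous u₀) (hne : u₀ ≠ 0) :
    ∃ A : ℝ, 0 < A ∧ ∀ t ∈ Ioc 0 S, ∀ x, A * intrinsicTime p Λ t ^ m ≤ μ t x := by
  obtain ⟨A₀, M, hA₀, hM, h0⟩ := H.exists_initial_lower_bound hm hμ hsup hu₀ hcont hne
  have hm1 := H.one_le_exponent hm
  have hp := H.p_pos
  have hp1 := H.p_lt
  have hsm := shellMass_pos H.dim_pos
  have hlo := H.comp.lo_pos
  set ε := shellMass n * lo * exp (-(2 * M)) with hε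
  have hε0 : 0 < ε := by positivity
  -- Below the fixed point `(ε/m)^m` of `A ↦ A^p ε/m` the iteration does not decrease `A`, so one
  -- constant serves all steps.
  set A := min A₀ ((ε / m) ^ m) with hAdef
  have hA : 0 < A := lt_min hA₀ (by positivity)
  have hGpos : ∀ t ∈ Ioc 0 S, 0 < intrinsicTime p Λ t := fun t ht =>
    intrinsicTime_pos H.comp.continuous H.comp.pos ht.1
  have hAε : A ≤ A ^ p * ε / m := by
    have h1 : A ^ (1 - p) ≤ ε / m := by
      calc A ^ (1 - p) ≤ ((ε / m) ^ m) ^ (1 - p) :=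
            Real.rpow_le_rpow hA.le (min_le_right _ _) (by linarith)
        _ = ε / m := by
            rw [← Real.rpow_mul (by positivity), hm, one_div, inv_mul_cancel₀ (by linarith),
              Real.rpow_one]
    calc A = A ^ p * A ^ (1 - p) := by rw [← Real.rpow_add hA]; simp
      _ ≤ A ^ p * (ε / m) := by gcongr
      _ = _ := by ring
  have hk : ∀ k : ℕ, ∀ t ∈ Ioc 0 S, ∀ x,
      A * intrinsicTime p Λ t ^ m * exp (-(M * p ^ k * ‖x‖)) ≤ μ t x := by
    intro k
    induction k with
    | zero =>
      intro t ht x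
      refine le_trans ?_ (h0 t ht x)
      have := hGpos t ht
      rw [pow_zero, mul_one]
      gcongr
      exact min_le_left _ _
    | succ k ih =>
      intro t ht x
      have hstep := H.lower_bound_step hm hμ hsup hu₀ hA.le (ε := ε)
        (g := fun y => exp (-(M * p ^ k * ‖y‖))) (g' := fun y => exp (-(M * p ^ (k + 1) * ‖y‖)))
        (fun y => (exp_pos _).le) ih ?_ ht x
      · refine le_trans ?_ hstep
        have := hGpos t ht
        gcongr
      · intro τ hτ y
        have e : ∀ y : E n, exp (-(M * p ^ k * ‖y‖)) ^ p = exp (-(M * p ^ (k + 1) * ‖y‖)) :=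
          fun y => by rw [← exp_mul]; congr 1; ring
        simp only [e]
        refine H.besselOp_mul_exp_ge (by positivity) ?_ hτ y
        exact mul_le_of_le_one_right hM.le (pow_le_one₀ hp.le hp1.le)
  refine ⟨A, hA, fun t ht x => ?_⟩
  have hlim : Tendsto (fun k : ℕ => A * intrinsicTime p Λ t ^ m * exp (-(M * p ^ k * ‖x‖))) atTop
      (𝓝 (A * intrinsicTime p Λ t ^ m * exp (-(M * 0 * ‖x‖)))) :=
    ((continuous_exp.tendsto _).comp
      (((H.tendsto_pow_zero.const_mul M).mul_const ‖x‖).neg)).const_mul _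
  have := le_of_tendsto' hlim fun k => hk k t ht x
  simpa using this

/-- The sharp lower bound for supersolutions. -/
theorem lower_bound (H : Regime n p σ a R S T Λ lo hi V) (hm : m = 1 / (1 - p))
    (hμ : Profile R a C μ)
    (hsup : ∀ t ∈ Icc 0 S, ∀ x, u₀ x + ∫ τ in (0 : ℝ)..t, besselOp (source p V μ τ) x ≤ μ t x)
    (hu₀ : ∀ x, 0 ≤ u₀ x) (hcont : Continuous u₀) (hne : u₀ ≠ 0) {ε₀ : ℝ} (hε₀ : 0 < ε₀)
    (hB : BesselLowerBound T σ Λ lo V (σ * p / (1 - p)) ε₀) {t : ℝ} (ht : t ∈ Ioc 0 S)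
    {x : E n} (hx : x ≠ 0) :
    (ε₀ * lo / m) ^ m * intrinsicTime p Λ t ^ m * ‖x‖ ^ (σ * m) ≤ μ t x := by
  obtain ⟨A, hA, h0⟩ := H.exists_uniform_lower_bound hm hμ hsup hu₀ hcont hne
  have hm1 := H.one_le_exponent hm
  have hp := H.p_pos
  have hp1 := H.p_lt
  have hσ := H.σ_nonneg
  have hlo := H.comp.lo_pos
  have hmp := H.exponent_mul hm
  set D := (ε₀ * lo / m) ^ m with hD
  have hD0 : 0 < D := by positivity
  have hDp : ε₀ * lo / m = D ^ (1 - p) := by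
    rw [hD, ← Real.rpow_mul (by positivity), hm, one_div, inv_mul_cancel₀ (by linarith),
      Real.rpow_one]
  -- The exponents `e_k = σ m (1 - p^k)` solve `e_(k+1) = σ + p e_k`, and the coefficients solve
  -- `A_(k+1) = A_k^p ε₀ lo/m`. The estimate is applied with `d = p e_k ≤ σ p/(1-p)`, which explains
  -- the range of `d` in admissibility.
  have hk : ∀ k : ℕ, ∀ t ∈ Ioc 0 S, ∀ x : E n,
      D ^ (1 - p ^ k) * A ^ p ^ k * intrinsicTime p Λ t ^ m * ‖x‖ ^ (σ * m * (1 - p ^ k)) ≤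
        μ t x := by
    intro k
    induction k with
    | zero =>
      intro t ht x
      simpa using h0 t ht x
    | succ k ih =>
      intro t ht x
      have hpk : p ^ k ≤ 1 := pow_le_one₀ hp.le hp1.le
      have hpk0 : 0 < p ^ k := by positivity
      have hstep := H.lower_bound_step hm hμ hsup hu₀ (A := D ^ (1 - p ^ k) * A ^ p ^ k)
        (ε := ε₀ * lo) (g := fun y => ‖y‖ ^ (σ * m * (1 - p ^ k)))
        (g' := fun y => ‖y‖ ^ (σ * m * (1 - p ^ (k + 1)))) (by positivity)
        (fun y => by positivity) ih ?_ ht x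
      · refine le_trans (le_of_eq ?_) hstep
        congr 2
        rw [mul_div_assoc, hDp, Real.mul_rpow (by positivity) (by positivity),
          ← Real.rpow_mul hD0.le, ← Real.rpow_mul hA.le, mul_right_comm, ← Real.rpow_add hD0,
          pow_succ]
        congr 2
        ring
      · intro τ hτ y
        have e : ∀ y : E n, (‖y‖ ^ (σ * m * (1 - p ^ k))) ^ p =
            ‖y‖ ^ (σ * m * (1 - p ^ k) * p) := fun y => by rw [← Real.rpow_mul (norm_nonneg y)]
        simp only [e]
        have hd0 : 0 ≤ σ * m * (1 - p ^ k) * p := by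
          have : 0 ≤ 1 - p ^ k := by linarith
          positivity
        have hbound := hB (σ * m * (1 - p ^ k) * p) hd0 ?_ τ (H.mem_time τ hτ) y
        · refine le_trans (le_of_eq ?_) hbound
          rw [show σ + σ * m * (1 - p ^ k) * p = σ * m * (1 - p ^ (k + 1)) by
            rw [pow_succ]; linear_combination σ * (hmp) ]
          ring
        · rw [hm, le_div_iff₀ (by linarith)]
          have : σ * (1 / (1 - p)) * (1 - p ^ k) * p * (1 - p) = σ * p * (1 - p ^ k) := by
            have : 1 - p ≠ 0 := by linarith
            field_simp
          rw [this]
          exact mul_le_of_le_one_right (by positivity) (by linarith)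
  have hx0 : 0 < ‖x‖ := norm_pos_iff.2 hx
  have hpk := H.tendsto_pow_zero
  have hpk1 : Tendsto (fun k : ℕ => 1 - p ^ k) atTop (𝓝 (1 - 0)) := hpk.const_sub 1
  have hlim : Tendsto (fun k : ℕ => D ^ (1 - p ^ k) * A ^ p ^ k * intrinsicTime p Λ t ^ m *
      ‖x‖ ^ (σ * m * (1 - p ^ k))) atTop (𝓝 (D ^ ((1 : ℝ) - 0) * A ^ (0 : ℝ) *
        intrinsicTime p Λ t ^ m * ‖x‖ ^ (σ * m * (1 - 0)))) :=
    (((tendsto_const_nhds.rpow hpk1 (Or.inl hD0.ne')).mul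
      (tendsto_const_nhds.rpow hpk (Or.inl hA.ne'))).mul_const _).mul
      (tendsto_const_nhds.rpow (hpk1.const_mul _) (Or.inl hx0.ne'))
  have := le_of_tendsto' hlim fun k => hk k t ht x
  simpa using this

end Regime

/-! ### The difference of a subsolution and a supersolution -/

/-- A concave function lies below its tangent at `x`; no order between `x` and `y` is needed. -/
theorem rpow_sub_rpow_le_mul {p x y : ℝ} (hp : 0 ≤ p) (hp1 : p ≤ 1) (hx : 0 < x) (hy : 0 ≤ y) :
    y ^ p - x ^ p ≤ p * x ^ (p - 1) * (y - x) := by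
  have h := _root_.rpow_one_add_le_one_add_mul_self (s := y / x - 1)
    (by have : 0 ≤ y / x := by positivity
        linarith) hp hp1
  rw [add_sub_cancel, Real.div_rpow hy hx.le, div_le_iff₀ (by positivity)] at h
  have e : x ^ (p - 1) = x ^ p / x := Real.rpow_sub_one hx.ne' p
  rw [e]
  have : p * (x ^ p / x) * (y - x) = p * (y / x - 1) * x ^ p := by field_simp
  linarith

theorem rpow_sub_rpow_le_rpow {p x y r : ℝ} (hp : 0 ≤ p) (hp1 : p ≤ 1) (hx : 0 ≤ x) (hy : 0 ≤ y)
    (hr : 0 ≤ r) (h : y - x ≤ r) : y ^ p - x ^ p ≤ r ^ p := by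
  have h1 : y ^ p ≤ (x + r) ^ p := Real.rpow_le_rpow hy (by linarith) hp
  have h2 := Real.rpow_add_le_add_rpow hx hr hp hp1
  linarith

namespace Regime

variable {p σ a R S lo hi : ℝ} {T : EReal} {Λ : ℝ → ℝ} {V : ℝ → E n → ℝ} {C C' m : ℝ}
  {μ ω : ℝ → E n → ℝ} {u₀ v₀ : E n → ℝ}

/-- Subtracting the two integral inequalities turns a weighted bound on the sources into one on `ω -
μ`, at the price of the factor `expMoment`. The origin may be left out because `𝓑` ignores null
sets. -/
theorem sub_le_of_source_sub_le (H : Regime n p σ a R S T Λ lo hi V)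
    (hμ : Profile R a C μ) (hω : Profile R a C' ω)
    (hsup : ∀ t ∈ Icc 0 S, ∀ x, u₀ x + ∫ τ in (0 : ℝ)..t, besselOp (source p V μ τ) x ≤ μ t x)
    (hsub : ∀ t ∈ Icc 0 S, ∀ x, ω t x ≤ v₀ x + ∫ τ in (0 : ℝ)..t, besselOp (source p V ω τ) x)
    (hvu : ∀ x, v₀ x ≤ u₀ x) {t : ℝ} (ht : t ∈ Icc 0 S) {q : ℝ → ℝ}
    (hq : IntervalIntegrable q volume 0 t) (hq0 : ∀ τ ∈ Ioc 0 t, 0 ≤ q τ)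
    (hle : ∀ τ ∈ Ioc 0 t, ∀ y, y ≠ 0 →
      source p V ω τ y - source p V μ τ y ≤ q τ * weight R a y) (x : E n) :
    ω t x - μ t x ≤ expMoment n (a / R) * (∫ τ in (0 : ℝ)..t, q τ) * weight R a x := by
  have hiμ := H.intervalIntegrable_besselOp_source hμ ht x
  have hiω := H.intervalIntegrable_besselOp_source hω ht x
  have h1 : ∫ τ in (0 : ℝ)..t, besselOp (source p V ω τ) x ≤ ∫ τ in (0 : ℝ)..t,
      (besselOp (source p V μ τ) x + q τ * (expMoment n (a / R) * weight R a x)) := by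
    refine intervalIntegral.integral_mono_on_of_le_Ioo ht.1 hiω (hiμ.add (hq.mul_const _))
      fun τ hτ => ?_
    have hτt : τ ∈ Ioc 0 t := ⟨hτ.1, hτ.2.le⟩
    have hτS : τ ∈ Ioc 0 S := ⟨hτ.1, hτ.2.le.trans ht.2⟩
    have hw : Integrable (fun y : E n => besselKernel n (x - y) * (q τ * weight R a y)) := by
      refine integrable_besselKernel_mul H.dim_pos H.one_le_R H.a_nonneg H.a_le (C := q τ)
        ((continuous_weight H.a_nonneg).measurable.const_mul _) (fun y => ?_) x
      rw [abs_of_nonneg (mul_nonneg (hq0 τ hτt) (weight_pos H.one_le_R H.a_nonneg y).le)]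
    have hs := H.integrable_source hμ hτS x
    calc besselOp (source p V ω τ) x
        ≤ besselOp (fun y => source p V μ τ y + q τ * weight R a y) x := by
          refine besselOp_mono (H.integrable_source hω hτS x) ?_ ?_
          · simp only [mul_add]; exact hs.add hw
          · filter_upwards [ae_ne_zero H.dim_pos] with y hy
            linarith [hle τ hτt y hy]
      _ = besselOp (source p V μ τ) x + q τ * besselOp (weight R a) x := by
          rw [← besselOp_const_mul]
          unfold besselOp
          rw [← integral_add hs hw]
          simp only [mul_add]
      _ ≤ _ := by
          have := hq0 τ hτt
          gcongr
          exact besselOp_weight_le H.dim_pos H.one_le_R H.a_nonneg H.a_le x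
  rw [intervalIntegral.integral_add hiμ (hq.mul_const _), intervalIntegral.integral_mul_const] at h1
  have h2 := hsup t ht x
  have h3 := hsub t ht x
  have h4 := hvu x
  linarith

/-- Subadditivity of `r^p` needs no positivity of `μ`. The best constant `N` in a bound on `(0, t]`
satisfies `N ≤ N/2 + c hi N^p G(t)`, hence `N ≤ (2 c hi G(t))^m`, which is the rate `G^m`. -/
theorem exists_sub_le (H : Regime n p σ a R S T Λ lo hi V) (hm : m = 1 / (1 - p))
    (hμ : Profile R a C μ) (hω : Profile R a C' ω)
    (hsup : ∀ t ∈ Icc 0 S, ∀ x, u₀ x + ∫ τ in (0 : ℝ)..t, besselOp (source p V μ τ) x ≤ μ t x)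
    (hsub : ∀ t ∈ Icc 0 S, ∀ x, ω t x ≤ v₀ x + ∫ τ in (0 : ℝ)..t, besselOp (source p V ω τ) x)
    (hvu : ∀ x, v₀ x ≤ u₀ x) :
    ∃ K, 0 ≤ K ∧ ∀ t ∈ Ioc 0 S, ∀ x,
      ω t x - μ t x ≤ K * intrinsicTime p Λ t ^ m * weight R a x := by
  have hp := H.p_pos
  have hp1 := H.p_lt
  have hhi := H.comp.hi_pos
  have hΛ := H.comp.continuous
  have hm1 := H.one_le_exponent hm
  have hmono := strictMono_intrinsicTime (p := p) hΛ H.comp.pos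
  have hw : ∀ y : E n, 0 < weight R a y := weight_pos H.one_le_R H.a_nonneg
  set c := expMoment n (a / R) with hc
  have hc0 : 0 ≤ c := expMoment_nonneg _
  -- Chosen so that `c/l ≤ 1/2`: the linear term then contributes at most `N/2`.
  set l := 2 * c + 1 with hl
  have hl0 : 0 < l := by positivity
  refine ⟨(2 * c * hi) ^ m * exp (l * S), by positivity, fun t ht x => ?_⟩
  have hG := intrinsicTime_pos (p := p) hΛ H.comp.pos ht.1
  set G := intrinsicTime p Λ t with hGdef
  let B : Set ℝ := {N | 0 ≤ N ∧ ∀ τ ∈ Ioc 0 t, ∀ y, ω τ y - μ τ y ≤ N * exp (l * τ) * weight R a y}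
  have hBne : B.Nonempty := by
    have hC' := hω.bound_nonneg H.one_le_R H.a_nonneg
    refine ⟨C', hC', fun τ hτ y => ?_⟩
    have h1 := hω.le τ y
    have h2 := hμ.nonneg τ y
    have h3 : 1 ≤ exp (l * τ) := one_le_exp (mul_nonneg hl0.le hτ.1.le)
    have h4 : C' * weight R a y ≤ C' * exp (l * τ) * weight R a y :=
      mul_le_mul_of_nonneg_right (le_mul_of_one_le_right hC' h3) (hw y).le
    linarith
  have hBbdd : BddBelow B := ⟨0, fun N hN => hN.1⟩
  have hBimp : ∀ N ∈ B, N / 2 + c * hi * N ^ p * G ∈ B := by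
    rintro N ⟨hN0, hN⟩
    refine ⟨by positivity, fun s hs y => ?_⟩
    have hsS : s ∈ Icc 0 S := ⟨hs.1.le, hs.2.trans ht.2⟩
    have hgap := H.sub_le_of_source_sub_le hμ hω hsup hsub hvu hsS
      (q := fun τ => N * exp (l * τ) + hi * N ^ p * exp (l * s) * (exp ((1 - p) * τ) * Λ τ))
      (Continuous.intervalIntegrable (by fun_prop) _ _)
      (fun τ _ => by have := H.comp.pos τ; positivity) (fun τ hτ y _ => ?_) y
    · rw [intervalIntegral.integral_add (Continuous.intervalIntegrable (by fun_prop) _ _)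
        (Continuous.intervalIntegrable (by fun_prop) _ _), intervalIntegral.integral_const_mul,
        intervalIntegral.integral_const_mul, ← hc] at hgap
      change _ ≤ c * (_ + hi * N ^ p * exp (l * s) * intrinsicTime p Λ s) * _ at hgap
      refine hgap.trans ?_
      have h1 := integral_exp_mul_le (t := s) hl0
      have h2 : intrinsicTime p Λ s ≤ G := hmono.monotone hs.2
      have h3 : c * (N * (exp (l * s) / l)) ≤ N / 2 * exp (l * s) := by
        have : c / l ≤ 1 / 2 := by rw [div_le_iff₀ hl0]; linarith
        calc c * (N * (exp (l * s) / l)) = c / l * (N * exp (l * s)) := by ring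
          _ ≤ 1 / 2 * (N * exp (l * s)) := by gcongr
          _ = _ := by ring
      refine mul_le_mul_of_nonneg_right ?_ (hw y).le
      calc _ ≤ c * (N * (exp (l * s) / l) + hi * N ^ p * exp (l * s) * G) := by gcongr
        _ ≤ _ := by rw [mul_add]; linarith
    · have hτt : τ ∈ Ioc 0 t := ⟨hτ.1, hτ.2.trans hs.2⟩
      have hτS : τ ∈ Ioc 0 S := ⟨hτ.1, hτt.2.trans ht.2⟩
      have hd := hN τ hτt y
      have hr0 : 0 ≤ N * exp (l * τ) * weight R a y := by have := hw y; positivity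
      have h1 := rpow_sub_rpow_le_rpow hp.le hp1.le (hμ.nonneg τ y) (hω.nonneg τ y) hr0 hd
      have hV := H.comp.nonneg τ (H.mem_time τ hτS) y
      have h2 := mul_le_mul_of_nonneg_left h1 hV
      have h3 := H.potential_mul_rpow_le hτS (C := N * exp (l * τ)) (by positivity) y hr0 le_rfl
      have h4 : (N * exp (l * τ)) ^ p ≤ N ^ p * exp (l * s) := by
        rw [Real.mul_rpow hN0 (exp_pos _).le, ← exp_mul]
        have : l * τ * p ≤ l * s := by
          calc l * τ * p ≤ l * τ := mul_le_of_le_one_right (mul_nonneg hl0.le hτ.1.le) hp1.le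
            _ ≤ l * s := by gcongr; exact hτ.2
        gcongr
      have hΛτ := H.comp.pos τ
      have hwy := hw y
      have h5 : hi * Λ τ * (N * exp (l * τ)) ^ p * weight R a y ≤
          hi * Λ τ * (N ^ p * exp (l * s)) * weight R a y := by gcongr
      have h6 := mul_le_mul_of_nonneg_left (h2.trans (h3.trans h5)) (exp_pos ((1 - p) * τ)).le
      unfold source
      linarith
  set N := sInf B with hNdef
  have hNB : N ∈ B := by
    refine ⟨le_csInf hBne fun N hN => hN.1, fun τ hτ y => ?_⟩
    have hpos : 0 < exp (l * τ) * weight R a y := mul_pos (exp_pos _) (hw y)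
    rw [mul_assoc, ← div_le_iff₀ hpos]
    refine le_csInf hBne fun N hN => ?_
    rw [div_le_iff₀ hpos, ← mul_assoc]
    exact hN.2 τ hτ y
  have hNle : N ≤ (2 * c * hi * G) ^ m := by
    rcases hNB.1.eq_or_lt with h0 | h0
    · rw [← h0]; positivity
    · have h1 := csInf_le hBbdd (hBimp N hNB)
      rw [← hNdef] at h1
      have h2 : N ^ (1 - p) ≤ 2 * c * hi * G := by
        have e : N = N ^ p * N ^ (1 - p) := by rw [← Real.rpow_add h0]; simp
        have hNp : 0 < N ^ p := by positivity
        refine le_of_mul_le_mul_left ?_ hNp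
        rw [← e]; linarith
      calc N = (N ^ (1 - p)) ^ m := by
            rw [← Real.rpow_mul h0.le, hm, mul_one_div_cancel (by linarith), Real.rpow_one]
        _ ≤ _ := by gcongr
  have hfin := hNB.2 t ⟨ht.1, le_rfl⟩ x
  refine hfin.trans (mul_le_mul_of_nonneg_right ?_ (hw x).le)
  rw [Real.mul_rpow (by positivity) hG.le] at hNle
  have hexp : exp (l * t) ≤ exp (l * S) := by
    have := ht.2
    gcongr
  calc N * exp (l * t) ≤ (2 * c * hi) ^ m * G ^ m * exp (l * S) := by gcongr
    _ = _ := by ring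

/-- Comparison of sub- and supersolutions in mild form. -/
theorem comparison (H : Regime n p σ a R S T Λ lo hi V)
    (hμ : Profile R a C μ) (hω : Profile R a C' ω)
    (hsup : ∀ t ∈ Icc 0 S, ∀ x, u₀ x + ∫ τ in (0 : ℝ)..t, besselOp (source p V μ τ) x ≤ μ t x)
    (hsub : ∀ t ∈ Icc 0 S, ∀ x, ω t x ≤ v₀ x + ∫ τ in (0 : ℝ)..t, besselOp (source p V ω τ) x)
    (hvu : ∀ x, v₀ x ≤ u₀ x) (hu₀ : ∀ x, 0 ≤ u₀ x) (hcont : Continuous u₀) (hne : u₀ ≠ 0)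
    {ε₀ : ℝ} (hε₀ : 0 < ε₀) (hB : BesselLowerBound T σ Λ lo V (σ * p / (1 - p)) ε₀)
    (hκ : expMoment n (a / R) * (p * hi / (ε₀ * lo)) < 1) {t : ℝ} (ht : t ∈ Ioc 0 S) (x : E n) :
    ω t x ≤ μ t x := by
  obtain ⟨m, hm⟩ : ∃ m, m = 1 / (1 - p) := ⟨_, rfl⟩
  have hp := H.p_pos
  have hp1 := H.p_lt
  have hhi := H.comp.hi_pos
  have hlo := H.comp.lo_pos
  have hΛ := H.comp.continuous
  have hσ := H.σ_nonneg
  have hm1 := H.one_le_exponent hm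
  have hm1p : m * (p - 1) = -1 := by linarith [H.exponent_mul hm]
  have hmono := strictMono_intrinsicTime (p := p) hΛ H.comp.pos
  have hw : ∀ y : E n, 0 < weight R a y := weight_pos H.one_le_R H.a_nonneg
  obtain ⟨K, hK0, hK⟩ := H.exists_sub_le hm hμ hω hsup hsub hvu
  set c := expMoment n (a / R) with hc
  have hc0 : 0 ≤ c := expMoment_nonneg _
  set κ := p * hi / (ε₀ * lo) with hκdef
  have hκ0 : 0 < κ := by positivity
  -- Makes `c/l < 1 - cκ`, so that the contraction factor `θ = c/l + cκ` is below `1`.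
  set l := 2 * c / (1 - c * κ) + 1 with hl
  have h1cκ : 0 < 1 - c * κ := by linarith
  have hl0 : 0 < l := by positivity
  set θ := c * (1 / l + κ) with hθ
  have hθ0 : 0 ≤ θ := by positivity
  have hθ1 : θ < 1 := by
    have h1 : c / l < (1 - c * κ) := by
      rw [div_lt_iff₀ hl0, hl, mul_add, mul_div_cancel₀ _ h1cκ.ne']
      linarith
    have : θ = c / l + c * κ := by rw [hθ]; ring
    linarith
  have hiter : ∀ k : ℕ, ∀ s ∈ Ioc 0 S, ∀ y, ω s y - μ s y ≤
      K * θ ^ k * exp (l * s) * intrinsicTime p Λ s ^ m * weight R a y := by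
    intro k
    induction k with
    | zero =>
      intro s hs y
      have hG := intrinsicTime_pos (p := p) hΛ H.comp.pos hs.1
      refine (hK s hs y).trans ?_
      have := hw y
      have h1 : 1 ≤ exp (l * s) := one_le_exp (mul_nonneg hl0.le hs.1.le)
      rw [pow_zero, mul_one]
      gcongr
      exact le_mul_of_one_le_right hK0 h1
    | succ k ih =>
      intro s hs y
      have hsS : s ∈ Icc 0 S := ⟨hs.1.le, hs.2⟩
      set G := intrinsicTime p Λ s with hGdef
      set N := K * θ ^ k with hN
      have hN0 : 0 ≤ N := by positivity
      have hcr := continuous_intrinsicTime_rpow_mul (p := p) hΛ hm1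
      have hG := intrinsicTime_pos (p := p) hΛ H.comp.pos hs.1
      have hgap := H.sub_le_of_source_sub_le hμ hω hsup hsub hvu hsS
        (q := fun τ => N * G ^ m * exp (l * τ) + κ * N * m * exp (l * s) *
          (intrinsicTime p Λ τ ^ (m - 1) * (exp ((1 - p) * τ) * Λ τ)))
        (Continuous.intervalIntegrable (by fun_prop) _ _)
        (fun τ hτ => by
          have := H.comp.pos τ
          have := intrinsicTime_pos (p := p) hΛ H.comp.pos hτ.1
          positivity) (fun τ hτ y hy => ?_) y
      · rw [intervalIntegral.integral_add (Continuous.intervalIntegrable (by fun_prop) _ _)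
          ((hcr.const_mul _).intervalIntegrable _ _), intervalIntegral.integral_const_mul,
          intervalIntegral.integral_const_mul, integral_intrinsicTime_rpow_mul hΛ hm1] at hgap
        refine hgap.trans (mul_le_mul_of_nonneg_right ?_ (hw y).le)
        have h1 := integral_exp_mul_le (t := s) hl0
        calc _ ≤ c * (N * G ^ m * (exp (l * s) / l) + κ * N * m * exp (l * s) * (G ^ m / m)) := by
              gcongr
          _ = _ := by
              have : m ≠ 0 := by linarith
              rw [pow_succ, hθ, hN, hθ]
              field_simp
      · have hτS : τ ∈ Ioc 0 S := ⟨hτ.1, hτ.2.trans hs.2⟩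
        have hg := intrinsicTime_pos (p := p) hΛ H.comp.pos hτ.1
        have hgG : intrinsicTime p Λ τ ≤ G := hmono.monotone hτ.2
        set g := intrinsicTime p Λ τ with hgdef
        have hy0 : 0 < ‖y‖ := norm_pos_iff.2 hy
        have hwy := hw y
        have hT := H.mem_time τ hτS
        have hΛτ := H.comp.pos τ
        have hexp : exp (l * τ) ≤ exp (l * s) := by
          have := hτ.2
          gcongr
        have hlow := H.lower_bound hm hμ hsup hu₀ hcont hne hε₀ hB hτS hy
        rw [← hgdef] at hlow
        have hL0 : 0 < (ε₀ * lo / m) ^ m * g ^ m * ‖y‖ ^ (σ * m) := by positivity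
        have hμ0 : 0 < μ τ y := hL0.trans_le hlow
        have hLp : ((ε₀ * lo / m) ^ m * g ^ m * ‖y‖ ^ (σ * m)) ^ (p - 1) =
            (m / (ε₀ * lo)) * g⁻¹ * (‖y‖ ^ σ)⁻¹ := by
          rw [Real.mul_rpow (by positivity) (by positivity),
            Real.mul_rpow (by positivity) (by positivity), ← Real.rpow_mul (by positivity),
            ← Real.rpow_mul hg.le, ← Real.rpow_mul hy0.le, mul_assoc σ, hm1p, mul_neg_one,
            Real.rpow_neg_one, Real.rpow_neg_one, Real.rpow_neg hy0.le, inv_div]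
        have hμp : μ τ y ^ (p - 1) ≤ (m / (ε₀ * lo)) * g⁻¹ * (‖y‖ ^ σ)⁻¹ := by
          rw [← hLp]
          exact Real.rpow_le_rpow_of_nonpos hL0 hlow (by linarith)
        have hd := ih τ hτS y
        set W := N * exp (l * τ) * g ^ m * weight R a y with hW
        have hW0 : 0 ≤ W := by positivity
        have hV := H.comp.nonneg τ hT y
        have hVu := H.comp.upper τ hT y
        -- The sharp lower bound raised to the power `p - 1` contributes `|y|^(-σ)`, which cancels
        -- the growth of `V`, and `g⁻¹`, which turns the `g^m` in `W` into `g^(m-1)`.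
        have hVW : V τ y * (ω τ y ^ p - μ τ y ^ p) ≤ κ * m * Λ τ * g⁻¹ * W := by
          calc V τ y * (ω τ y ^ p - μ τ y ^ p)
              ≤ V τ y * (p * μ τ y ^ (p - 1) * W) := by
                refine mul_le_mul_of_nonneg_left
                  ((rpow_sub_rpow_le_mul hp.le hp1.le hμ0 (hω.nonneg τ y)).trans ?_) hV
                exact mul_le_mul_of_nonneg_left hd (by positivity)
            _ ≤ (hi * Λ τ * ‖y‖ ^ σ) * (p * ((m / (ε₀ * lo)) * g⁻¹ * (‖y‖ ^ σ)⁻¹) * W) := by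
                gcongr
            _ = _ := by
                rw [hκdef]
                field_simp
        have h1 : W ≤ N * G ^ m * exp (l * τ) * weight R a y := by
          calc W ≤ N * exp (l * τ) * G ^ m * weight R a y := by rw [hW]; gcongr
            _ = _ := by ring
        have h2 : g⁻¹ * W ≤ N * exp (l * s) * g ^ (m - 1) * weight R a y := by
          have e : g⁻¹ * g ^ m = g ^ (m - 1) := by
            rw [Real.rpow_sub_one hg.ne', div_eq_inv_mul]
          calc g⁻¹ * W = N * exp (l * τ) * (g⁻¹ * g ^ m) * weight R a y := by rw [hW]; ring
            _ ≤ _ := by rw [e]; gcongr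
        have h3 : exp ((1 - p) * τ) * (κ * m * Λ τ * g⁻¹ * W) ≤ exp ((1 - p) * τ) *
            (κ * m * Λ τ * (N * exp (l * s) * g ^ (m - 1) * weight R a y)) := by
          rw [mul_assoc _ g⁻¹ W]
          gcongr
        have h4 := mul_le_mul_of_nonneg_left hVW (exp_pos ((1 - p) * τ)).le
        unfold source
        linarith
  have hlim : Tendsto (fun k : ℕ => K * θ ^ k * exp (l * t) * intrinsicTime p Λ t ^ m *
      weight R a x) atTop (𝓝 (K * 0 * exp (l * t) * intrinsicTime p Λ t ^ m * weight R a x)) :=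
    ((((tendsto_pow_atTop_nhds_zero_of_lt_one hθ0 hθ1).const_mul K).mul_const _).mul_const
      _).mul_const _
  have := ge_of_tendsto' hlim fun k => hiter k t ht x
  simp at this
  linarith

end Regime

/-! ### Comparison of s-supersolutions and s-subsolutions -/

theorem initial_time_le {p : ℝ} {V : ℝ → E n → ℝ} {T : EReal} {a : ℝ} {u₀ v₀ : E n → ℝ}
    {u v : ℝ → E n → ℝ} (hT : 0 < T) (hvu : ∀ x, v₀ x ≤ u₀ x)
    (hu : IsSSupersolution p V T a u₀ u) (hv : IsSSubsolution p V T a v₀ v) (x : E n) :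
    v 0 x ≤ u 0 x := by
  have h0 : (0 : ℝ) ∈ timeIco T := ⟨le_rfl, by simpa using hT⟩
  have h1 := hu.ge 0 h0 x
  have h2 := hv.le 0 h0 x
  simp [sMildOp] at h1 h2
  linarith [hvu x]

theorem sMildOp_congr {p : ℝ} {V V' : ℝ → E n → ℝ} {u₀ : E n → ℝ} {μ μ' : ℝ → E n → ℝ} {t : ℝ}
    (ht : 0 ≤ t) (hμ : ∀ τ ∈ Ioc 0 t, μ τ = μ' τ) (hV : ∀ τ ∈ Ioc 0 t, V τ = V' τ) (x : E n) :
    sMildOp p V u₀ μ t x = sMildOp p V' u₀ μ' t x := by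
  unfold sMildOp
  congr 1
  · congr 1
    refine intervalIntegral.integral_congr_ae (Eventually.of_forall fun τ hτ => ?_)
    rw [uIoc_of_le ht] at hτ
    simp only [hμ τ hτ]
  · refine intervalIntegral.integral_congr_ae (Eventually.of_forall fun τ hτ => ?_)
    rw [uIoc_of_le ht] at hτ
    simp only [hμ τ hτ, hV τ hτ]

theorem comparison_of_isComparable (hn : 1 ≤ n) {σ p : ℝ} (hσ : 0 ≤ σ) (hp0 : 0 < p) (hp1 : p < 1)
    {T : EReal} {Λ : ℝ → ℝ} {lo hi : ℝ} {V : ℝ → E n → ℝ} {ε₀ a : ℝ} {u₀ v₀ : E n → ℝ}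
    {u v : ℝ → E n → ℝ} (hT : 0 < T) (hV : IsComparable T σ Λ lo hi V) (hε₀ : 0 < ε₀)
    (hB : BesselLowerBound T σ Λ lo V (σ * p / (1 - p)) ε₀) (hp : p < ε₀ * (lo / hi))
    (ha : max σ 0 / (1 - p) ≤ a) (hu₀ : MemBC a u₀) (hv₀ : ∀ x, 0 ≤ v₀ x)
    (hvu : ∀ x, v₀ x ≤ u₀ x) (hne : u₀ ≠ 0) (hu : IsSSupersolution p V T a u₀ u)
    (hv : IsSSubsolution p V T a v₀ v) {t : ℝ} (ht : t ∈ timeIco T) (x : E n) : v t x ≤ u t x := by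
  rcases ht.1.eq_or_lt with rfl | ht0
  · exact initial_time_le hT hvu hu hv x
  have hlo := hV.lo_pos
  have hhi := hV.hi_pos
  rw [max_eq_left hσ, div_le_iff₀ (by linarith), mul_comm] at ha
  set κ := p * hi / (ε₀ * lo) with hκ
  have hκ0 : 0 < κ := by positivity
  have hκ1 : κ < 1 := by
    rw [hκ, div_lt_one (by positivity)]
    rw [← mul_div_assoc, lt_div_iff₀ hhi] at hp
    exact hp
  -- The midpoint of `1` and `κ⁻¹` exceeds `1`, and its product with `κ` is `(1 + κ)/2 < 1`.
  obtain ⟨R, hR1, hR2, hR3⟩ := exists_expMoment_le hn a (κ := (1 + κ⁻¹) / 2)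
    (by have := (one_lt_inv₀ hκ0).2 hκ1
        linarith)
  have H : Regime n p σ a R t T Λ lo hi V :=
    ⟨hn, hp0, hp1, hσ, ha, hR1, hR2, ht0, fun τ hτ =>
      ⟨hτ.1, (timeIco_of_le ht ⟨hτ.1.le, hτ.2⟩).2⟩, hV⟩
  obtain ⟨C, hμ⟩ := exists_profile (R := R) H.a_nonneg hR1 hu.memZ hu.nonneg ht
  obtain ⟨C', hω⟩ := exists_profile (R := R) H.a_nonneg hR1 hv.memZ hv.nonneg ht
  have hcl : ∀ s ∈ Icc 0 t, ∀ w : ℝ → E n → ℝ, ∀ τ ∈ Ioc 0 s,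
      (fun y => exp (clamp t τ) * w (clamp t τ) y) = fun y => exp τ * w τ y := by
    intro s hs w τ hτ
    rw [clamp_of_mem ⟨hτ.1.le, hτ.2.trans hs.2⟩]
  have key := H.comparison hμ hω (u₀ := u₀) (v₀ := v₀) (fun s hs y => ?_) (fun s hs y => ?_) hvu
    (fun y => (hv₀ y).trans (hvu y)) hu₀.1 hne hε₀ hB ?_ (t := t) ⟨ht0, le_rfl⟩ x
  · simp only [clamp_of_mem (show t ∈ Icc 0 t from ⟨ht0.le, le_rfl⟩)] at key
    exact le_of_mul_le_mul_left key (exp_pos t)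
  · rw [← H.sMildOp_eq hμ hs, sMildOp_congr hs.1 (hcl s hs u) (fun _ _ => rfl), clamp_of_mem hs]
    exact hu.ge s (timeIco_of_le ht hs) y
  · rw [← H.sMildOp_eq hω hs, sMildOp_congr hs.1 (hcl s hs v) (fun _ _ => rfl), clamp_of_mem hs]
    exact hv.le s (timeIco_of_le ht hs) y
  · calc expMoment n (a / R) * κ ≤ (1 + κ⁻¹) / 2 * κ := by gcongr
      _ = (1 + κ) / 2 := by field_simp; ring
      _ < 1 := by linarith

/-! ### The pure power potential -/

/-- The bound on `d` matters when `σ = 0`: it forces `d = 0`, whereas for `n = 1` a small positive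
`d` would lie outside `J_1⁺`. -/
theorem add_mem_JPlus {σ d D : ℝ} (hσ : σ ∈ JPlus n) (hd : 0 ≤ d) (hdD : d ≤ σ * D) :
    σ + d ∈ JPlus n := by
  obtain ⟨h1, h0⟩ := hσ
  refine ⟨?_, by positivity⟩
  rcases h0.eq_or_lt with rfl | hpos
  · have : d = 0 := by linarith
    simp [this]
  · have h2 : 0 ≤ σ + n - 2 := nonneg_of_mul_nonneg_right h1 hpos
    have h3 : 0 ≤ σ + d := by positivity
    exact mul_nonneg h3 (by linarith)

theorem isComparable_power {T : EReal} {σ : ℝ} {Λ : ℝ → ℝ} (hΛ : Continuous Λ)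
    (hpos : ∀ t, 0 < Λ t) : IsComparable T σ Λ 1 1 (fun t (x : E n) => Λ t * ‖x‖ ^ σ) where
  continuous := hΛ
  pos := hpos
  lo_pos := one_pos
  hi_pos := one_pos
  measurable := by fun_prop
  nonneg := fun t _ x => mul_nonneg (hpos t).le (by positivity)
  lower := fun t _ x _ => by rw [one_mul]
  upper := fun t _ x => by rw [one_mul]

theorem besselLowerBound_power (hn : 1 ≤ n) {T : EReal} {σ p : ℝ} {Λ : ℝ → ℝ} (hσ : σ ∈ JPlus n)
    (hpos : ∀ t, 0 < Λ t) :
    BesselLowerBound T σ Λ 1 (fun t (x : E n) => Λ t * ‖x‖ ^ σ) (σ * p / (1 - p)) 1 := by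
  intro d hd hdD t _ x
  have h := norm_rpow_le_besselOp hn (add_mem_JPlus (D := p / (1 - p)) hσ hd
    (by rwa [← mul_div_assoc])) x
  have e : (fun y : E n => Λ t * ‖y‖ ^ σ * ‖y‖ ^ d) = fun y => Λ t * ‖y‖ ^ (σ + d) := by
    ext y
    rw [Real.rpow_add_of_nonneg (norm_nonneg y) hσ.2 hd, mul_assoc]
  rw [e, besselOp_const_mul, one_mul, one_mul]
  exact mul_le_mul_of_nonneg_left h (hpos t).le

/-- In part (2) `V` is prescribed on `(0, T)` only, so it is exchanged for the globally defined
power, which is known to be measurable. -/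
theorem IsSSupersolution.congr_potential {p : ℝ} {V V' : ℝ → E n → ℝ} {T : EReal} {a : ℝ}
    {u₀ : E n → ℝ} {u : ℝ → E n → ℝ} (h : IsSSupersolution p V T a u₀ u)
    (hV : ∀ t ∈ timeIoo T, V t = V' t) : IsSSupersolution p V' T a u₀ u :=
  ⟨h.nonneg, h.memZ, fun t ht x => by
    rw [← sMildOp_congr ht.1 (fun _ _ => rfl) fun τ hτ =>
      hV τ ⟨hτ.1, (timeIco_of_le ht ⟨hτ.1.le, hτ.2⟩).2⟩]
    exact h.ge t ht x⟩

theorem IsSSubsolution.congr_potential {p : ℝ} {V V' : ℝ → E n → ℝ} {T : EReal} {a : ℝ}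
    {v₀ : E n → ℝ} {v : ℝ → E n → ℝ} (h : IsSSubsolution p V T a v₀ v)
    (hV : ∀ t ∈ timeIoo T, V t = V' t) : IsSSubsolution p V' T a v₀ v :=
  ⟨h.nonneg, h.memZ, fun t ht x => by
    rw [← sMildOp_congr ht.1 (fun _ _ => rfl) fun τ hτ =>
      hV τ ⟨hτ.1, (timeIco_of_le ht ⟨hτ.1.le, hτ.2⟩).2⟩]
    exact h.le t ht x⟩

end Pseudoparabolic

end

theorem mainTheorem4 (n : ℕ) (hn : 1 ≤ n) (σ : ℝ) (hσ : σ ∈ Pseudoparabolic.JPlus n)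
    (p : ℝ) (hp0 : 0 < p) (hp1 : p < 1) :
    -- an admissible constant `ε₀`, depending on `n`, `σ`, `p` only, exists
    (∃ ε₀ : ℝ, 0 < ε₀ ∧
      ∀ (τ₀ : EReal) (Λ : ℝ → ℝ) (lo hi : ℝ) (V : ℝ → Pseudoparabolic.E n → ℝ),
        Pseudoparabolic.IsComparable τ₀ σ Λ lo hi V →
        Pseudoparabolic.BesselLowerBound τ₀ σ Λ lo V (σ * p / (1 - p)) ε₀) ∧
    -- comparison for every admissible `ε₀` and `p < ε₀ lo / hi`
    (∀ (τ₀ : EReal) (Λ : ℝ → ℝ) (lo hi : ℝ) (V : ℝ → Pseudoparabolic.E n → ℝ) (ε₀ a : ℝ)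
        (u₀ v₀ : Pseudoparabolic.E n → ℝ) (u v : ℝ → Pseudoparabolic.E n → ℝ),
      0 < τ₀ →
      Pseudoparabolic.IsComparable τ₀ σ Λ lo hi V →
      0 < ε₀ →
      Pseudoparabolic.BesselLowerBound τ₀ σ Λ lo V (σ * p / (1 - p)) ε₀ →
      p < ε₀ * (lo / hi) →
      max σ 0 / (1 - p) ≤ a →
      Pseudoparabolic.MemBC a u₀ → Pseudoparabolic.MemBC a v₀ →
      (∀ x, 0 ≤ v₀ x) → (∀ x, v₀ x ≤ u₀ x) → u₀ ≠ 0 →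
      Pseudoparabolic.IsSSupersolution p V τ₀ a u₀ u →
      Pseudoparabolic.IsSSubsolution p V τ₀ a v₀ v →
      ∀ t ∈ Pseudoparabolic.timeIco τ₀, ∀ x, v t x ≤ u t x) ∧
    -- comparison for all `0 < p < 1` when `V = Λ(t) |x|^σ`
    (∀ (τ₀ : EReal) (Λ : ℝ → ℝ) (V : ℝ → Pseudoparabolic.E n → ℝ) (a : ℝ)
        (u₀ v₀ : Pseudoparabolic.E n → ℝ) (u v : ℝ → Pseudoparabolic.E n → ℝ),
      0 < τ₀ →
      Continuous Λ → (∀ t, 0 < Λ t) →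
      (∀ t ∈ Pseudoparabolic.timeIoo τ₀, ∀ x, V t x = Λ t * ‖x‖ ^ σ) →
      max σ 0 / (1 - p) ≤ a →
      Pseudoparabolic.MemBC a u₀ → Pseudoparabolic.MemBC a v₀ →
      (∀ x, 0 ≤ v₀ x) → (∀ x, v₀ x ≤ u₀ x) → u₀ ≠ 0 →
      Pseudoparabolic.IsSSupersolution p V τ₀ a u₀ u →
      Pseudoparabolic.IsSSubsolution p V τ₀ a v₀ v →
      ∀ t ∈ Pseudoparabolic.timeIco τ₀, ∀ x, v t x ≤ u t x) := by
  refine ⟨⟨Pseudoparabolic.shellMass n, Pseudoparabolic.shellMass_pos hn,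
    fun τ₀ Λ lo hi V hV => Pseudoparabolic.besselLowerBound_shellMass hn hσ.2 hV⟩, ?_, ?_⟩
  · intro τ₀ Λ lo hi V ε₀ a u₀ v₀ u v hT hV hε₀ hB hp ha hu₀ _ hv₀ hvu hne hu hv t ht x
    exact Pseudoparabolic.comparison_of_isComparable hn hσ.2 hp0 hp1 hT hV hε₀ hB hp ha hu₀ hv₀
      hvu hne hu hv ht x
  · intro τ₀ Λ V a u₀ v₀ u v hT hΛ hpos hV ha hu₀ _ hv₀ hvu hne hu hv t ht x
    have hV' : ∀ t ∈ Pseudoparabolic.timeIoo τ₀, V t = fun x => Λ t * ‖x‖ ^ σ :=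
      fun t ht => funext fun x => hV t ht x
    exact Pseudoparabolic.comparison_of_isComparable hn hσ.2 hp0 hp1 hT
      (Pseudoparabolic.isComparable_power hΛ hpos) one_pos
      (Pseudoparabolic.besselLowerBound_power hn hσ hpos) (by simpa using hp1) ha hu₀ hv₀ hvu hne
      (hu.congr_potential hV') (hv.congr_potential hV') ht x
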